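/- All graphs are finite, simple and undirected, and all trees are nonempty. Let $G$ be a graph and $X\subseteq V(G)$. A set $D\subseteq V(G)$ is $X$-dominating if every vertex in $X\setminus D$ has a neighbor in $D$. For $g:V(G)\to\{0,1,2\}$ and distinct vertices $u,v$, let $g_{v\to u}$ be the function that takes the value $g(u)+1$ at $u$, $g(v)-1$ at $v$, and agrees with $g$ elsewhere. If $g(u)=0$, say that $u$ is defended by $g$ if $u$ has a neighbor $v$ with $g(v)\ge 1$ such that $\{x\in V(G): g_{v\to u}(x)\ge 1\}$ is $X$-dominating. A $(G,X)$-RDF is a function $f:V(G)\to\{0,1,2\}$ such that every $u\in X$ with $f(u)=0$ has a neighbor $v$ with $f(v)=2$. A $(G,X)$-WRDF is a function $g:V(G)\to\{0,1,2\}$ such that every $u\in X$ with $g(u)=0$ is defended by $g$. A $(G,X)$-WRDF is minimum if its weight $\sum_{x\in V(G)}g(x)$ is smallest among all $(G,X)$-WRDFs. The Roman domination number $\gamma_R(G)$ strongly equals the weak Roman domination number $\gamma_r(G)$ if every minimum $(G,V(G))$-WRDF is a $(G,V(G))$-RDF. Let $\mathcal S$ be the set of all triples $(T,X,Y)$ such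 that $T$ is a tree, $X,Y\subseteq V(T)$, every minimum $(T,X)$-WRDF is a $(T,X)$-RDF, and $Y$ is the set of all vertices $u$ for which there is a minimum $(T,X)$-WRDF $g$ such that either $g(u)\ge 1$, or $g(u)=0$ and $u$ is defended by $g$. Let $(T,X,Y)$ be such that $T$ is a tree and $X\subseteq Y\subseteq V(T)$. A triple $(T^+,X^+,Y^+)$ arises from $(T,X,Y)$ by * Operation 1, if for some vertex $u\notin Y$ of $T$, the tree $T^+$ arises from $T$ by adding a new vertex $v$ and the edge $uv$, $X^+=X$, and $Y^+=Y$; * Operation 2, if for some vertex $u\notin Y$ of $T$, the tree $T^+$ arises from $T$ by adding three new vertices $v,w_1,w_2$ and the edges $uv,vw_1,vw_2$, $X^+$ is $X\cup\{u,w_1,w_2\}$ or $X\cup\{u,v,w_1,w_2\}$, and $Y^+=Y\cup\{u,v,w_1,w_2\}$; * Operation 3, if for some vertex $u\notin X$ of $T$, the tree $T^+$ arises from $T$ by adding four new vertices $v,w_1,w_2,w_3$ and the edges $uv,vw_1,vw_2,vw_3$, $X^+=X\cup\{w_1,w_2,w_3\}\cup Z$ for some $Z\subseteq\{u,v\}$,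 and $Y^+=Y\cup\{u,v,w_1,w_2,w_3\}$. For the last two operations, call $(u,v,w_1,\ldots,w_k)$ a configuration of $(T,X,Y)$ if $v$ is a vertex of $T$ whose neighbors are the distinct vertices $u,w_1,\ldots,w_k$ and, with $W_i$ denoting the vertex set of the component of $T-v$ that contains $w_i$, there is some $\ell\in\{1,\ldots,k\}$ such that $W_i\cap X=\{w_i\}$ for $i\le\ell$, $W_i\cap X=\emptyset$ for $i>\ell$, $u,v\in Y$, $W_i\cap Y=\{w_i\}$ for all $i\in\{1,\ldots,k\}$, and either $\ell=2$ and $u\in X$, or $\ell\ge 3$. A triple $(T^+,X^+,Y^+)$ arises from $(T,X,Y)$ by * Operation 4, if for some configuration, $T^+$ arises from $T$ by adding a new vertex $v^*$ and the edge $vv^*$, $X^+$ is $X$ or $X\cup\{v^*\}$, and $Y^+=Y\cup\{v^*\}$; * Operation 5, if for some configuration and some $i\in\{1,\ldots,k\}$, $T^+$ arises from $T$ by adding a new vertex $v^*$ and the edge $w_iv^*$, $X^+=X$, and $Y^+=Y$. Let $\mathcal T$ be the set of all triples that can be obtained from (copies of) $(K_1,\emptyset,\emptyset)$ and $(K_1,V(K_1),V(K_1))$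 by finitely many (possibly zero) applications of Operations 1 to 5. Theorem. $\mathcal S=\mathcal T$. In particular, for a tree $T$, the Roman domination number of $T$ strongly equals the weak Roman domination number of $T$ if and only if $(T,V(T),V(T))\in\mathcal T$. -/

import Mathlib

universe u

namespace RomanTrees

open scoped Classical in
/-- The function `g_{v → u}`: one unit is moved from `v` to `u` (used for distinct `u`, `v`). -/
noncomputable def shift {V : Type u} (g : V → ℕ) (v u : V) : V → ℤ :=
  fun x => if x = u then (g u : ℤ) + 1 else if x = v then (g v : ℤ) - 1 else (g x : ℤ)

/-- `D` is `X`-dominating: every vertex in `X \ D` has a neighbor in `D`. -/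
def IsDominating {V : Type u} (G : SimpleGraph V) (X D : Set V) : Prop :=
  ∀ x ∈ X \ D, ∃ y ∈ D, G.Adj x y

/-- `u` has a neighbor `v` with `g v ≥ 1` such that `{x | g_{v → u} x ≥ 1}` is `X`-dominating. -/
def IsDefended {V : Type u} (G : SimpleGraph V) (X : Set V) (g : V → ℕ) (u : V) : Prop :=
  ∃ v, G.Adj u v ∧ 1 ≤ g v ∧ IsDominating G X {x | 1 ≤ shift g v u x}

/-- `f` is a Roman dominating function for `(G, X)`, with values in `{0, 1, 2}`. -/
def IsRDF {V : Type u} (G : SimpleGraph V) (X : Set V) (f : V → ℕ) : Prop :=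
  (∀ x, f x ∈ ({0, 1, 2} : Set ℕ)) ∧ ∀ u ∈ X, f u = 0 → ∃ v, G.Adj u v ∧ f v = 2

/-- `g` is a weak Roman dominating function for `(G, X)`, with values in `{0, 1, 2}`. -/
def IsWRDF {V : Type u} (G : SimpleGraph V) (X : Set V) (g : V → ℕ) : Prop :=
  (∀ x, g x ∈ ({0, 1, 2} : Set ℕ)) ∧ ∀ u ∈ X, g u = 0 → IsDefended G X g u

/-- The weight of a function on the vertices of a finite graph. -/
def weight {V : Type u} [Fintype V] (g : V → ℕ) : ℕ := ∑ x, g x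

/-- The weak Roman domination number of `(G, X)` (the constant function `1` is always a weak
Roman dominating function, so this is a minimum over a nonempty set). -/
noncomputable def weakRomanNumber {V : Type u} [Fintype V] (G : SimpleGraph V) (X : Set V) : ℕ :=
  sInf {n | ∃ g : V → ℕ, IsWRDF G X g ∧ weight g = n}

/-- `g` is a minimum weak Roman dominating function for `(G, X)`. -/
def IsMinWRDF {V : Type u} [Fintype V] (G : SimpleGraph V) (X : Set V) (g : V → ℕ) : Prop :=
  IsWRDF G X g ∧ weight g = weakRomanNumber G X

/-- The Roman domination number of `G` strongly equals the weak Roman domination number of `G`. -/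
def StronglyEqual {V : Type u} [Fintype V] (G : SimpleGraph V) : Prop :=
  ∀ g, IsMinWRDF G Set.univ g → IsRDF G Set.univ g

/-- A finite simple graph `T` together with two sets `X` and `Y` of its vertices. -/
structure Triple where
  /-- The vertex set. -/
  V : Type u
  /-- The vertex set is finite. -/
  fintypeV : Fintype V
  /-- The graph. -/
  T : SimpleGraph V
  /-- The first set of vertices. -/
  X : Set V
  /-- The second set of vertices. -/
  Y : Set V

attribute [instance] Triple.fintypeV

/-- The set `𝒮`. -/
def setS : Set Triple.{u} :=
  {A | A.T.IsTree ∧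
    (∀ g, IsMinWRDF A.T A.X g → IsRDF A.T A.X g) ∧
    A.Y = {u | ∃ g, IsMinWRDF A.T A.X g ∧ (1 ≤ g u ∨ (g u = 0 ∧ IsDefended A.T A.X g u))}}

/-- The standing assumption on triples to which an operation is applied. -/
def Triple.IsAdmissible (A : Triple.{u}) : Prop := A.T.IsTree ∧ A.X ⊆ A.Y

/-- Via the embedding `φ`, the graph `H` arises from `G` by adding the vertices in `N` as new
vertices and the edges in `E` as new edges. -/
def ArisesByAdding {V W : Type u} (G : SimpleGraph V) (H : SimpleGraph W) (φ : V ↪ W)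
    (N : Set W) (E : Set (Sym2 W)) : Prop :=
  (Set.range φ)ᶜ = N ∧ H.edgeSet = Sym2.map φ '' G.edgeSet ∪ E

/-- Operation 1: attach a new endvertex `v` to a vertex `u ∉ Y`. -/
def Op1 (A B : Triple.{u}) : Prop :=
  A.IsAdmissible ∧
  ∃ (φ : A.V ↪ B.V) (u : A.V) (v : B.V), u ∉ A.Y ∧
    ArisesByAdding A.T B.T φ {v} {s(φ u, v)} ∧
    B.X = φ '' A.X ∧
    B.Y = φ '' A.Y

/-- Operation 2: attach a star with center `v` and two leaves `w₁, w₂` to a vertex `u ∉ Y`. -/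
def Op2 (A B : Triple.{u}) : Prop :=
  A.IsAdmissible ∧
  ∃ (φ : A.V ↪ B.V) (u : A.V) (v w₁ w₂ : B.V), u ∉ A.Y ∧
    [v, w₁, w₂].Nodup ∧
    ArisesByAdding A.T B.T φ {v, w₁, w₂} {s(φ u, v), s(v, w₁), s(v, w₂)} ∧
    (B.X = φ '' A.X ∪ {φ u, w₁, w₂} ∨ B.X = φ '' A.X ∪ {φ u, v, w₁, w₂}) ∧
    B.Y = φ '' A.Y ∪ {φ u, v, w₁, w₂}

/-- Operation 3: attach a star with center `v` and three leaves `w₁, w₂, w₃` to a vertex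
`u ∉ X`. -/
def Op3 (A B : Triple.{u}) : Prop :=
  A.IsAdmissible ∧
  ∃ (φ : A.V ↪ B.V) (u : A.V) (v w₁ w₂ w₃ : B.V), u ∉ A.X ∧
    [v, w₁, w₂, w₃].Nodup ∧
    ArisesByAdding A.T B.T φ {v, w₁, w₂, w₃}
      {s(φ u, v), s(v, w₁), s(v, w₂), s(v, w₃)} ∧
    (B.X = φ '' A.X ∪ {w₁, w₂, w₃} ∨ B.X = φ '' A.X ∪ {φ u, w₁, w₂, w₃} ∨
      B.X = φ '' A.X ∪ {v, w₁, w₂, w₃} ∨ B.X = φ '' A.X ∪ {φ u, v, w₁, w₂, w₃}) ∧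
    B.Y = φ '' A.Y ∪ {φ u, v, w₁, w₂, w₃}

/-- For `w ≠ v`, the vertex set of the component of `T - v` that contains `w`. -/
def branch {V : Type u} (T : SimpleGraph V) (v w : V) : Set V :=
  {x | ∃ (hw : w ∈ ({v}ᶜ : Set V)) (hx : x ∈ ({v}ᶜ : Set V)),
    (T.induce ({v}ᶜ : Set V)).Reachable ⟨w, hw⟩ ⟨x, hx⟩}

/-- The configuration around `v` needed for Operations 4 and 5. The neighbors of `v` are
`u, w₁, …, w_k` (distinct; `w i` stands for `w_{i+1}`), and `W_i` is the vertex set of the component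
of `T - v` that contains `w_i`. For some `ℓ ∈ {1, …, k}`, we have `W_i ∩ X = {w_i}` for `i ≤ ℓ` and
`W_i ∩ X = ∅` for `i > ℓ`. Moreover, `u, v ∈ Y`, `W_i ∩ Y = {w_i}` for all `i`, and either `ℓ = 2`
and `u ∈ X`, or `ℓ ≥ 3`. -/
def Triple.IsConfiguration (A : Triple.{u}) (u v : A.V) (k : ℕ) (w : Fin k → A.V) : Prop :=
  Function.Injective w ∧ u ∉ Set.range w ∧
  A.T.neighborSet v = {u} ∪ Set.range w ∧
  ∃ ℓ : ℕ, 1 ≤ ℓ ∧ ℓ ≤ k ∧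
    (∀ i : Fin k, (i : ℕ) < ℓ → branch A.T v (w i) ∩ A.X = {w i}) ∧
    (∀ i : Fin k, ℓ ≤ (i : ℕ) → branch A.T v (w i) ∩ A.X = ∅) ∧
    ((ℓ = 2 ∧ u ∈ A.X ∧ u ∈ A.Y ∧ v ∈ A.Y ∧ ∀ i, branch A.T v (w i) ∩ A.Y = {w i}) ∨
      (3 ≤ ℓ ∧ u ∈ A.Y ∧ v ∈ A.Y ∧ ∀ i, branch A.T v (w i) ∩ A.Y = {w i}))

/-- Operation 4: attach a new endvertex `z` to the vertex `v` of a configuration. -/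
def Op4 (A B : Triple.{u}) : Prop :=
  A.IsAdmissible ∧
  ∃ (φ : A.V ↪ B.V) (u v : A.V) (k : ℕ) (w : Fin k → A.V) (z : B.V),
    A.IsConfiguration u v k w ∧
    ArisesByAdding A.T B.T φ {z} {s(φ v, z)} ∧
    (B.X = φ '' A.X ∨ B.X = φ '' A.X ∪ {z}) ∧
    B.Y = φ '' A.Y ∪ {z}

/-- Operation 5: attach a new endvertex `z` to one of the vertices `w_i` of a configuration. -/
def Op5 (A B : Triple.{u}) : Prop :=
  A.IsAdmissible ∧
  ∃ (φ : A.V ↪ B.V) (u v : A.V) (k : ℕ) (w : Fin k → A.V) (i : Fin k) (z : B.V),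
    A.IsConfiguration u v k w ∧
    ArisesByAdding A.T B.T φ {z} {s(φ (w i), z)} ∧
    B.X = φ '' A.X ∧
    B.Y = φ '' A.Y

/-- Membership in `𝒯`: the triples generated from `(K₁, ∅, ∅)` and `(K₁, V(K₁), V(K₁))` by the five
operations. (A simple graph with exactly one vertex is a copy of `K₁`.) -/
inductive Generated : Triple.{u} → Prop
  | base_empty (A : Triple.{u}) (hV : Fintype.card A.V = 1) (hX : A.X = ∅) (hY : A.Y = ∅) :
      Generated A
  | base_full (A : Triple.{u}) (hV : Fintype.card A.V = 1) (hX : A.X = Set.univ)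
      (hY : A.Y = Set.univ) : Generated A
  | step (A B : Triple.{u}) (hA : Generated A)
      (hAB : Op1 A B ∨ Op2 A B ∨ Op3 A B ∨ Op4 A B ∨ Op5 A B) : Generated B

/-- The set `𝒯`. -/
def setT : Set Triple.{u} := {A | Generated A}

end RomanTrees

/-! Call a graph with a demand set `X` strong if all its minimum weak Roman functions are Roman.
Everything rests on an exchange argument, `Strong.exists_isPrivate`: where a minimum function of a
strong pair has value 2, at `v` say, at least three demanded zero vertices have `v` as their only
positive neighbor. With at most one such private neighbor, lowering `v` to 1 would save weight. With
two, one unit could move from `v` to one of them, and the other would be defended without seeing a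
2.

Growing. Each operation attaches an endvertex or a star by a single edge. An undemanded endvertex
leaves the minimum weight unchanged, because its units may as well sit on its neighbor; in a tree,
strength is preserved exactly when that neighbor never has value 1 (`LeafExt.strong`,
`LeafExt.apply_ne_one`). In Operations 1 and 5 the neighbor always has value 0, in Operation 4
always 2. A star with two demanded leaves costs exactly 2 (`StarExt.isMinWRDF_comp`). All of this
sits at the center if a third leaf is demanded, or if the attachment vertex is demanded but not
coverable from the old tree. The minimum functions of both trees then correspond, and `Y` can be
read off.

Shrinking. A hub is an edge `uv` such that, on the side of `v`, demands occur only at `v` and its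
neighbors, and at some neighbor. A strong tree with two or more vertices and a demand has one
(`exists_isHub`). At a hub every minimum function has value 2 at `v` and 0 on the rest of the branch
(`IsHub.apply_eq`), so for members of `setS` hubs and configurations amount to the same. If the
branch reaches beyond the neighbors of `v`, an undemanded endvertex can be removed (Operation 1 or
5). If it is a star with an undemanded leaf or with at least four leaves, one leaf can be removed
(Operation 4). Otherwise the star has two or three demanded leaves and is removed as a whole
(Operation 2 or 3). Without demands, any endvertex can be removed by Operation 1. -/

namespace RomanTrees

/-! ### Weak Roman functions and the exchange argument -/

section Basic

variable {V : Type u} {G : SimpleGraph V} {X : Set V} {g : V → ℕ}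

/-- Moving one unit from `v` to its neighbor `u` leaves a function with dominating support. -/
def Defends (G : SimpleGraph V) (X : Set V) (g : V → ℕ) (u v : V) : Prop :=
  G.Adj u v ∧ 1 ≤ g v ∧
    ∀ x ∈ X, ∃ y, (y = x ∨ G.Adj x y) ∧ (y = u ∨ (1 ≤ g y ∧ (y = v → 2 ≤ g v)))

/-- Unfolding the shift removes the integers: the donor stays in the support only if it had value 2.
-/
theorem isDefended_iff {u : V} : IsDefended G X g u ↔ ∃ v, Defends G X g u v := by
  refine exists_congr fun v => and_congr_right fun huv => and_congr_right fun hv => ?_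
  have key : ∀ y, y ∈ {x | 1 ≤ shift g v u x} ↔ (y = u ∨ (1 ≤ g y ∧ (y = v → 2 ≤ g v))) := by
    intro y
    have hne := huv.ne
    simp only [shift, Set.mem_ofPred_eq]
    split_ifs with h1 h2
    · simp [h1]
    · subst h2; simp [h1]; omega
    · simp [h1, h2]
  constructor
  · intro h x hx
    by_cases hxD : x ∈ {x | 1 ≤ shift g v u x}
    · exact ⟨x, Or.inl rfl, (key x).1 hxD⟩
    · obtain ⟨y, hy, hxy⟩ := h x ⟨hx, hxD⟩
      exact ⟨y, Or.inr hxy, (key y).1 hy⟩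
  · rintro h x ⟨hx, hxD⟩
    obtain ⟨y, hxy, hy⟩ := h x hx
    rcases hxy with rfl | hxy
    · exact absurd ((key y).2 hy) hxD
    · exact ⟨y, (key y).2 hy, hxy⟩

theorem mem_values_iff {n : ℕ} : n ∈ ({0, 1, 2} : Set ℕ) ↔ n ≤ 2 := by
  simp; omega

theorem IsWRDF.le_two (h : IsWRDF G X g) (x : V) : g x ≤ 2 := mem_values_iff.1 (h.1 x)

/-- A weak Roman dominating function dominates. -/
theorem IsWRDF.dominates (h : IsWRDF G X g) {x : V} (hx : x ∈ X) :
    1 ≤ g x ∨ ∃ y, G.Adj x y ∧ 1 ≤ g y := by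
  by_cases h0 : g x = 0
  · obtain ⟨v, hv, h1, -⟩ := h.2 x hx h0
    exact Or.inr ⟨v, hv, h1⟩
  · exact Or.inl (by omega)

theorem IsRDF.dominates (h : IsRDF G X g) {x : V} (hx : x ∈ X) :
    1 ≤ g x ∨ ∃ y, G.Adj x y ∧ g y = 2 := by
  by_cases h0 : g x = 0
  · exact Or.inr (h.2 x hx h0)
  · exact Or.inl (by omega)

/-- If the support of `g` dominates, then vertices with a neighbor of value `2` are defended. -/
theorem isDefended_of_adj_two {u v : V} (huv : G.Adj u v) (hv : g v = 2)
    (hdom : ∀ x ∈ X, 1 ≤ g x ∨ ∃ y, G.Adj x y ∧ 1 ≤ g y) : IsDefended G X g u := by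
  rw [isDefended_iff]
  refine ⟨v, huv, by omega, fun x hx => ?_⟩
  rcases hdom x hx with h | ⟨y, hxy, h⟩
  · exact ⟨x, Or.inl rfl, Or.inr ⟨h, fun _ => by omega⟩⟩
  · exact ⟨y, Or.inr hxy, Or.inr ⟨h, fun _ => by omega⟩⟩

theorem IsRDF.isWRDF (h : IsRDF G X g) : IsWRDF G X g := by
  refine ⟨h.1, fun u hu hu0 => ?_⟩
  obtain ⟨v, huv, hv⟩ := h.2 u hu hu0
  refine isDefended_of_adj_two huv hv fun x hx => ?_
  rcases h.dominates hx with h | ⟨y, hy, h⟩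
  · exact Or.inl h
  · exact Or.inr ⟨y, hy, by omega⟩

theorem isWRDF_one (G : SimpleGraph V) (X : Set V) : IsWRDF G X (fun _ => 1) :=
  ⟨fun _ => by simp, fun _ _ h => absurd h one_ne_zero⟩

/-- Lowering the value at `v` from `2` to `1` (and possibly raising other values) keeps a function
weakly Roman dominating if at most one zero vertex relied on `v` alone. -/
theorem isWRDF_of_lower (hR : IsRDF G X g) {h : V → ℕ} {v b : V} (hh : ∀ x, h x ≤ 2)
    (hv : g v = 2) (hv' : h v = 1) (hle : ∀ x, x ≠ v → g x ≤ h x)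
    (hP : ∀ x ∈ X, G.Adj x v → h x = 0 → (∀ y, G.Adj x y → y ≠ v → g y = 0) → x = b) :
    IsWRDF G X h := by
  have hle2 : ∀ y, y ≠ v → g y = 2 → h y = 2 := fun y hy h2 =>
    le_antisymm (hh y) (h2 ▸ hle y hy)
  have hpos : ∀ y, 1 ≤ g y → 1 ≤ h y := fun y hy => by
    rcases eq_or_ne y v with rfl | hne
    · omega
    · exact hy.trans (hle y hne)
  have hdom : ∀ x ∈ X, 1 ≤ h x ∨ ∃ y, G.Adj x y ∧ 1 ≤ h y := fun x hx => by
    rcases hR.dominates hx with h1 | ⟨y, hy, h1⟩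
    · exact Or.inl (hpos x h1)
    · exact Or.inr ⟨y, hy, hpos y (by omega)⟩
  refine ⟨fun x => mem_values_iff.2 (hh x), fun x hx hx0 => ?_⟩
  have hxv : x ≠ v := by rintro rfl; omega
  have hgx : g x = 0 := by have := hle x hxv; omega
  obtain ⟨y, hxy, hy⟩ := hR.2 x hx hgx
  rcases eq_or_ne y v with rfl | hyv
  swap
  · exact isDefended_of_adj_two hxy (hle2 y hyv hy) hdom
  -- If `x` relies on the lowered vertex (now `y`) alone, it is the exception `b` and receives the
  -- remaining unit of `y`. Otherwise another positive neighbor donates and `y` keeps its unit.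
  by_cases hxP : ∀ z, G.Adj x z → z ≠ y → g z = 0
  · obtain rfl := hP x hx hxy hx0 hxP
    rw [isDefended_iff]
    refine ⟨y, hxy, by omega, fun q hq => ?_⟩
    by_cases hq0 : h q = 0
    · by_cases hqP : ∀ z, G.Adj q z → z ≠ y → g z = 0
      · have hqy : q ≠ y := by rintro rfl; omega
        have hgq : g q = 0 := by have := hle q hqy; omega
        obtain ⟨z, hqz, hz⟩ := hR.2 q hq hgq
        have : z = y := by
          by_contra hne
          have := hqP z hqz hne
          omega
        subst this
        exact ⟨q, Or.inl rfl, Or.inl (hP q hq hqz hq0 hqP)⟩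
      · push Not at hqP
        obtain ⟨z, hqz, hzy, hz⟩ := hqP
        exact ⟨z, Or.inr hqz, Or.inr ⟨hpos z (by omega), fun h => absurd h hzy⟩⟩
    · by_cases hqy : q = y
      · subst hqy
        exact ⟨x, Or.inr hxy.symm, Or.inl rfl⟩
      · exact ⟨q, Or.inl rfl, Or.inr ⟨by omega, fun h => absurd h hqy⟩⟩
  · push Not at hxP
    obtain ⟨z, hxz, hzy, hz⟩ := hxP
    rw [isDefended_iff]
    refine ⟨z, hxz, hpos z (by omega), fun q hq => ?_⟩
    by_cases hq0 : h q = 0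
    · have hqy : q ≠ y := by rintro rfl; omega
      have hgq : g q = 0 := by have := hle q hqy; omega
      obtain ⟨t, hqt, ht⟩ := hR.2 q hq hgq
      refine ⟨t, Or.inr hqt, Or.inr ⟨hpos t (by omega), ?_⟩⟩
      rintro rfl
      have := hle2 t hzy ht
      omega
    · by_cases hqz : q = z
      · subst hqz
        exact ⟨x, Or.inr hxz.symm, Or.inl rfl⟩
      · exact ⟨q, Or.inl rfl, Or.inr ⟨by omega, fun h => absurd h hqz⟩⟩

/-- `x` is a zero vertex in `X` whose only positive neighbor is `v`. -/
def IsPrivate (G : SimpleGraph V) (X : Set V) (g : V → ℕ) (v x : V) : Prop :=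
  x ∈ X ∧ G.Adj x v ∧ g x = 0 ∧ ∀ y, G.Adj x y → y ≠ v → g y = 0

variable [Fintype V]

theorem isMinWRDF_iff :
    IsMinWRDF G X g ↔ IsWRDF G X g ∧ ∀ h, IsWRDF G X h → weight g ≤ weight h := by
  have hne : {n | ∃ g : V → ℕ, IsWRDF G X g ∧ weight g = n}.Nonempty :=
    ⟨_, _, isWRDF_one G X, rfl⟩
  refine and_congr_right fun hg => ⟨fun h k hk => ?_, fun h => le_antisymm ?_ ?_⟩
  · rw [h]; exact Nat.sInf_le ⟨k, hk, rfl⟩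
  · obtain ⟨k, hk, hk'⟩ := Nat.sInf_mem hne
    rw [weakRomanNumber, ← hk']
    exact h k hk
  · exact Nat.sInf_le ⟨g, hg, rfl⟩

theorem exists_isMinWRDF (G : SimpleGraph V) (X : Set V) : ∃ g, IsMinWRDF G X g := by
  have hne : {n | ∃ g : V → ℕ, IsWRDF G X g ∧ weight g = n}.Nonempty :=
    ⟨_, _, isWRDF_one G X, rfl⟩
  obtain ⟨k, hk, hk'⟩ := Nat.sInf_mem hne
  exact ⟨k, hk, hk'⟩

theorem IsMinWRDF.weight_le (hg : IsMinWRDF G X g) {h : V → ℕ} (hh : IsWRDF G X h) :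
    weight g ≤ weight h := (isMinWRDF_iff.1 hg).2 h hh

theorem IsMinWRDF.of_weight_le (hg : IsMinWRDF G X g) {h : V → ℕ} (hh : IsWRDF G X h)
    (hw : weight h ≤ weight g) : IsMinWRDF G X h :=
  isMinWRDF_iff.2 ⟨hh, fun _ hk => hw.trans (hg.weight_le hk)⟩

theorem weight_update [DecidableEq V] (g : V → ℕ) (a : V) (n : ℕ) :
    weight (Function.update g a n) + g a = weight g + n := by
  unfold weight
  rw [Finset.sum_update_of_mem (Finset.mem_univ a), ← Finset.add_sum_erase _ g (Finset.mem_univ a),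
    Finset.sdiff_singleton_eq_erase]
  omega

/-- Every minimum weak Roman dominating function for `(G, X)` is Roman dominating. -/
def Strong (G : SimpleGraph V) (X : Set V) : Prop := ∀ g, IsMinWRDF G X g → IsRDF G X g

/-- The vertices that are positive or defended for some minimum weak Roman dominating function. -/
def coverable (G : SimpleGraph V) (X : Set V) : Set V :=
  {u | ∃ g, IsMinWRDF G X g ∧ (1 ≤ g u ∨ (g u = 0 ∧ IsDefended G X g u))}

theorem subset_coverable (G : SimpleGraph V) (X : Set V) : X ⊆ coverable G X := by
  intro x hx
  obtain ⟨g, hg⟩ := exists_isMinWRDF G X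
  refine ⟨g, hg, ?_⟩
  by_cases h0 : g x = 0
  · exact Or.inr ⟨h0, hg.1.2 x hx h0⟩
  · exact Or.inl (by omega)

theorem mem_coverable_of_adj_two (hg : IsMinWRDF G X g) {u v : V} (huv : G.Adj u v)
    (hv : g v = 2) : u ∈ coverable G X := by
  refine ⟨g, hg, ?_⟩
  by_cases h0 : g u = 0
  · exact Or.inr ⟨h0, isDefended_of_adj_two huv hv fun x hx => hg.1.dominates hx⟩
  · exact Or.inl (by omega)

/-- A vertex of value `1` in a minimum function that is Roman dominating belongs to `X` and has no
neighbor of value `2`. -/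
theorem IsMinWRDF.of_eq_one (hg : IsMinWRDF G X g) (hR : IsRDF G X g) {p : V} (hp : g p = 1) :
    p ∈ X ∧ ∀ y, G.Adj p y → g y ≠ 2 := by
  classical
  by_contra hcon
  -- In a Roman function no other vertex relies on a value 1, so if `p` is undemanded or sees a 2,
  -- its unit is superfluous.
  have hR' : IsRDF G X (Function.update g p 0) := by
    refine ⟨fun x => ?_, fun x hx hx0 => ?_⟩
    · rcases eq_or_ne x p with rfl | h
      · simp
      · rw [Function.update_of_ne h]; exact hR.1 x
    · rcases eq_or_ne x p with rfl | h
      · simp only [hx, true_and, not_forall, not_not] at hcon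
        obtain ⟨y, hy, hy2⟩ := hcon
        exact ⟨y, hy, by rw [Function.update_of_ne hy.ne']; exact hy2⟩
      · rw [Function.update_of_ne h] at hx0
        obtain ⟨y, hy, hy2⟩ := hR.2 x hx hx0
        refine ⟨y, hy, ?_⟩
        rw [Function.update_of_ne]
        · exact hy2
        · rintro rfl; omega
  have h1 := hg.weight_le hR'.isWRDF
  have h2 := weight_update g p 0
  omega

/-- In a strong graph, the private neighbors of a vertex of value `2` cannot be covered by two
vertices. -/
theorem Strong.exists_isPrivate (hS : Strong G X) (hg : IsMinWRDF G X g) {v : V} (hv : g v = 2)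
    (a b : V) : ∃ x, IsPrivate G X g v x ∧ x ≠ a ∧ x ≠ b := by
  classical
  by_contra! hcon
  have hR := hS g hg
  -- With at most one private neighbor, value 1 at `v` suffices and the weight drops.
  have one : ∀ b, ¬ (∀ x, IsPrivate G X g v x → x = b) := by
    intro b hb
    have hw := weight_update g v 1
    have : IsWRDF G X (Function.update g v 1) := by
      refine isWRDF_of_lower (b := b) hR (fun x => ?_) hv (by simp) (fun x hx => ?_) ?_
      · rcases eq_or_ne x v with rfl | h
        · simp
        · rw [Function.update_of_ne h]; exact hg.1.le_two x
      · rw [Function.update_of_ne hx]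
      · intro x hx hxv hx0 hP
        rw [Function.update_of_ne hxv.ne] at hx0
        exact hb x ⟨hx, hxv, hx0, hP⟩
    have := hg.weight_le this
    omega
  by_cases hab : a = b
  · subst hab
    exact one a fun x hx => by by_contra h; exact h (hcon x hx h)
  by_cases ha : IsPrivate G X g v a
  swap
  · refine one b fun x hx => hcon x hx ?_
    rintro rfl; exact ha hx
  by_cases hb : IsPrivate G X g v b
  swap
  · refine one a fun x hx => ?_
    by_contra h
    obtain rfl := hcon x hx h
    exact hb hx
  -- Now `a` and `b` are the only private neighbors. A unit moves from `v` to `a`: the weight is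
  -- unchanged and `b` is still defended, but no neighbor of `b` has value 2.
  set h := Function.update (Function.update g v 1) a 1 with hdef
  have hav : a ≠ v := ha.2.1.ne
  have hbv : b ≠ v := hb.2.1.ne
  have hhv : h v = 1 := by rw [hdef, Function.update_of_ne hav.symm]; simp
  have hho : ∀ x, x ≠ v → x ≠ a → h x = g x := fun x h1 h2 => by
    rw [hdef, Function.update_of_ne h2, Function.update_of_ne h1]
  have hha : h a = 1 := by simp [hdef]
  have hW : IsWRDF G X h := by
    refine isWRDF_of_lower (b := b) hR (fun x => ?_) hv hhv (fun x hx => ?_) ?_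
    · rcases eq_or_ne x v with rfl | h1
      · omega
      rcases eq_or_ne x a with rfl | h2
      · omega
      · rw [hho x h1 h2]; exact hg.1.le_two x
    · rcases eq_or_ne x a with rfl | h2
      · rw [ha.2.2.1]; omega
      · rw [hho x hx h2]
    · intro x hx hxv hx0 hP
      have hxa : x ≠ a := by rintro rfl; omega
      rw [hho x hxv.ne hxa] at hx0
      exact hcon x ⟨hx, hxv, hx0, hP⟩ hxa
  have hw1 := weight_update g v 1
  have hw2 : weight h + _ = _ := weight_update (Function.update g v 1) a 1
  rw [Function.update_of_ne hav, ha.2.2.1] at hw2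
  have hR' := hS h (hg.of_weight_le hW (by omega))
  have hb0 : h b = 0 := by rw [hho b hbv (Ne.symm hab)]; exact hb.2.2.1
  obtain ⟨y, hby, hy⟩ := hR'.2 b hb.1 hb0
  have h1 : y ≠ v := by rintro rfl; omega
  have h2 : y ≠ a := by rintro rfl; omega
  rw [hho y h1 h2, hb.2.2.2 y hby h1] at hy
  omega

end Basic

/-! ### Graphs attached by a single edge -/

/-- `H` arises from `G`, embedded by `φ`, by attaching a graph at `v` to `u` with one edge. -/
structure PendantExt {V W : Type u} (G : SimpleGraph V) (H : SimpleGraph W) (φ : V ↪ W)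
    (u : V) (v : W) : Prop where
  adj_iff : ∀ a b, H.Adj (φ a) (φ b) ↔ G.Adj a b
  cross : ∀ a x, x ∉ Set.range φ → (H.Adj (φ a) x ↔ a = u ∧ x = v)
  notMem : v ∉ Set.range φ

section Transfer

variable {V W : Type u} {G : SimpleGraph V} {H : SimpleGraph W} {φ : V ↪ W} {u : V} {v : W}
  {X : Set V} {X' : Set W}

theorem PendantExt.adj (P : PendantExt G H φ u v) : H.Adj (φ u) v :=
  (P.cross u v P.notMem).2 ⟨rfl, rfl⟩

/-- Restriction loses only the domination of `u` by `v`; `hc` says that it does not occur or is not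
needed. -/
theorem PendantExt.defends_comp (P : PendantExt G H φ u v) (hX : φ '' X ⊆ X') {h : W → ℕ}
    (hc : h v = 0 ∨ u ∉ X) {x b : V} (hd : Defends H X' h (φ x) (φ b)) :
    Defends G X (h ∘ φ) x b := by
  obtain ⟨h1, h2, h3⟩ := hd
  refine ⟨(P.adj_iff _ _).1 h1, h2, fun q hq => ?_⟩
  obtain ⟨y, hy, hy'⟩ := h3 (φ q) (hX ⟨q, hq, rfl⟩)
  by_cases hyr : y ∈ Set.range φ
  · obtain ⟨y, rfl⟩ := hyr
    exact ⟨y, by simpa [P.adj_iff] using hy, by simpa using hy'⟩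
  · exfalso
    rcases hy with rfl | hy
    · exact hyr ⟨q, rfl⟩
    · obtain ⟨rfl, rfl⟩ := (P.cross q y hyr).1 hy
      rcases hc with hc | hc
      · rcases hy' with rfl | hy'
        · exact hyr ⟨x, rfl⟩
        · omega
      · exact hc hq

/-- Each new demand must be met by a vertex that stays positive when `φ b` gives a unit away: one
outside the image, or one of value 2. -/
theorem PendantExt.defends_of_comp (P : PendantExt G H φ u v) {h : W → ℕ}
    (hX : ∀ p ∈ X', p ∉ φ '' X →
      ∃ y, (y = p ∨ H.Adj p y) ∧ 1 ≤ h y ∧ (y ∈ Set.range φ → h y = 2))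
    {x b : V} (hd : Defends G X (h ∘ φ) x b) : Defends H X' h (φ x) (φ b) := by
  obtain ⟨h1, h2, h3⟩ := hd
  refine ⟨(P.adj_iff _ _).2 h1, h2, fun q hq => ?_⟩
  by_cases hqX : q ∈ φ '' X
  · obtain ⟨q, hqX, rfl⟩ := hqX
    obtain ⟨y, hy, hy'⟩ := h3 q hqX
    exact ⟨φ y, by simpa [P.adj_iff] using hy, by simpa using hy'⟩
  · obtain ⟨y, hy, hy1, hy2⟩ := hX q hq hqX
    refine ⟨y, hy, Or.inr ⟨hy1, ?_⟩⟩
    rintro rfl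
    exact (hy2 ⟨b, rfl⟩).ge

theorem weight_eq_comp_add [Fintype V] [Fintype W] [DecidablePred (· ∉ Set.range φ)] (h : W → ℕ) :
    weight h = weight (h ∘ φ) + ∑ x with x ∉ Set.range φ, h x := by
  classical
  unfold weight
  rw [← Finset.sum_filter_add_sum_filter_not Finset.univ (fun x => x ∈ Set.range φ) h]
  congr 1
  · have : Finset.univ.filter (fun x => x ∈ Set.range φ) = Finset.univ.map φ := by
      ext x; simp
    rw [this, Finset.sum_map]
    rfl

end Transfer

/-! ### Attaching an undemanded endvertex -/

section Leaf

variable {V W : Type u} {G : SimpleGraph V} {H : SimpleGraph W} {φ : V ↪ W} {u : V} {z : W}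
  {X : Set V}

/-- `H` arises from `G` by attaching the new endvertex `z` to `u`. -/
structure LeafExt (G : SimpleGraph V) (H : SimpleGraph W) (φ : V ↪ W) (u : V) (z : W) : Prop
    extends PendantExt G H φ u z where
  eq_of_notMem : ∀ x, x ∉ Set.range φ → x = z

theorem LeafExt.cases (P : LeafExt G H φ u z) (x : W) : x = z ∨ ∃ a, φ a = x := by
  by_cases h : x ∈ Set.range φ
  · exact Or.inr h
  · exact Or.inl (P.eq_of_notMem x h)

theorem LeafExt.eq_of_adj (P : LeafExt G H φ u z) {x : W} (h : H.Adj z x) : x = φ u := by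
  rcases P.cases x with rfl | ⟨a, rfl⟩
  · exact absurd rfl h.ne
  · rw [((P.cross a z P.notMem).1 h.symm).1]

/-- Extension of a function by the value zero. -/
noncomputable def extendZero (φ : V ↪ W) (g : V → ℕ) : W → ℕ := Function.extend φ g 0

@[simp] theorem extendZero_apply (g : V → ℕ) (a : V) : extendZero φ g (φ a) = g a :=
  φ.injective.extend_apply _ _ _

theorem extendZero_of_notMem (g : V → ℕ) {x : W} (hx : x ∉ Set.range φ) : extendZero φ g x = 0 :=
  Function.extend_apply' _ _ _ hx

@[simp] theorem extendZero_comp (g : V → ℕ) : extendZero φ g ∘ φ = g := by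
  ext a; simp

theorem LeafExt.eq_extendZero (P : LeafExt G H φ u z) {h : W → ℕ} (hz : h z = 0) :
    h = extendZero φ (h ∘ φ) := by
  ext x
  rcases P.cases x with rfl | ⟨a, rfl⟩
  · rw [hz, extendZero_of_notMem _ P.notMem]
  · simp

theorem LeafExt.extendZero_le_two (P : LeafExt G H φ u z) {g : V → ℕ}
    (h : ∀ a, g a ∈ ({0, 1, 2} : Set ℕ)) (x : W) : extendZero φ g x ∈ ({0, 1, 2} : Set ℕ) := by
  rcases P.cases x with rfl | ⟨a, rfl⟩
  · rw [extendZero_of_notMem _ P.notMem]; simp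
  · rw [extendZero_apply]; exact h a

theorem LeafExt.isWRDF_extendZero (P : LeafExt G H φ u z) {g : V → ℕ} (hg : IsWRDF G X g) :
    IsWRDF H (φ '' X) (extendZero φ g) := by
  refine ⟨P.extendZero_le_two hg.1, ?_⟩
  rintro _ ⟨x, hx, rfl⟩ h0
  rw [extendZero_apply] at h0
  obtain ⟨b, hb⟩ := isDefended_iff.1 (hg.2 x hx h0)
  exact isDefended_iff.2 ⟨φ b, P.defends_of_comp (fun p hp hp' => absurd hp hp') (by simpa using hb)⟩

theorem LeafExt.isRDF_extendZero (P : LeafExt G H φ u z) {g : V → ℕ} :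
    IsRDF H (φ '' X) (extendZero φ g) ↔ IsRDF G X g := by
  constructor
  · intro h
    refine ⟨fun a => by simpa using h.1 (φ a), fun x hx hx0 => ?_⟩
    obtain ⟨y, hy, hy2⟩ := h.2 (φ x) ⟨x, hx, rfl⟩ (by simpa using hx0)
    rcases P.cases y with rfl | ⟨b, rfl⟩
    · rw [extendZero_of_notMem _ P.notMem] at hy2
      omega
    · exact ⟨b, (P.adj_iff _ _).1 hy, by simpa using hy2⟩
  · intro h
    refine ⟨P.extendZero_le_two h.1, ?_⟩
    rintro _ ⟨x, hx, rfl⟩ h0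
    obtain ⟨y, hy, hy2⟩ := h.2 x hx (by simpa using h0)
    exact ⟨φ y, (P.adj_iff _ _).2 hy, by simpa using hy2⟩

open scoped Classical in
/-- The value at the endvertex `z` is moved to its neighbor. -/
noncomputable def pushLeaf (φ : V ↪ W) (u : V) (z : W) (h : W → ℕ) : V → ℕ :=
  Function.update (h ∘ φ) u (min 2 (h (φ u) + h z))

theorem pushLeaf_self (h : W → ℕ) : pushLeaf φ u z h u = min 2 (h (φ u) + h z) := by
  simp [pushLeaf]

theorem pushLeaf_of_ne (h : W → ℕ) {a : V} (ha : a ≠ u) : pushLeaf φ u z h a = h (φ a) := by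
  simp [pushLeaf, ha]

/-- The endvertex is undemanded and can serve only `u`; its units serve at least as well when placed
on `u` itself. -/
theorem LeafExt.isWRDF_pushLeaf (P : LeafExt G H φ u z) {h : W → ℕ}
    (hh : IsWRDF H (φ '' X) h) : IsWRDF G X (pushLeaf φ u z h) := by
  have hle : ∀ a, h (φ a) ≤ pushLeaf φ u z h a := fun a => by
    rcases eq_or_ne a u with rfl | ha
    · rw [pushLeaf_self]; have := hh.le_two (φ a); omega
    · rw [pushLeaf_of_ne h ha]
  refine ⟨fun a => mem_values_iff.2 ?_, fun x hx hx0 => ?_⟩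
  · rcases eq_or_ne a u with rfl | ha
    · rw [pushLeaf_self]; omega
    · rw [pushLeaf_of_ne h ha]; exact hh.le_two _
  have hx0' : h (φ x) = 0 := by have := hle x; omega
  obtain ⟨y, hxy, hy1, hd⟩ := isDefended_iff.1 (hh.2 _ ⟨x, hx, rfl⟩ hx0')
  obtain ⟨b, rfl⟩ : ∃ b, φ b = y := by
    rcases P.cases y with rfl | h
    · obtain ⟨rfl, -⟩ := (P.cross x y P.notMem).1 hxy
      rw [pushLeaf_self] at hx0
      omega
    · exact h
  refine isDefended_iff.2 ⟨b, (P.adj_iff _ _).1 hxy, hy1.trans (hle b), fun q hq => ?_⟩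
  obtain ⟨y, hqy, hy⟩ := hd _ ⟨q, hq, rfl⟩
  rcases P.cases y with rfl | ⟨y, rfl⟩
  · have hqu : q = u := by
      rcases hqy with h | h
      · exact absurd ⟨q, h.symm⟩ P.notMem
      · exact ((P.cross q y P.notMem).1 h).1
    have hz : 1 ≤ h y := by
      rcases hy with h | h
      · exact absurd ⟨x, h.symm⟩ P.notMem
      · exact h.1
    refine ⟨q, Or.inl rfl, Or.inr ⟨?_, ?_⟩⟩
    · rw [hqu, pushLeaf_self]; omega
    · rintro rfl
      rw [hqu, pushLeaf_self, ← hqu]; omega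
  · refine ⟨y, by simpa [P.adj_iff] using hqy, ?_⟩
    rcases hy with h | ⟨h1, h2⟩
    · exact Or.inl (φ.injective h)
    · refine Or.inr ⟨h1.trans (hle y), ?_⟩
      rintro rfl
      exact (h2 rfl).trans (hle y)

theorem LeafExt.defends_extendZero (P : LeafExt G H φ u z) {g : V → ℕ} {a : V} :
    IsDefended H (φ '' X) (extendZero φ g) (φ a) ↔ IsDefended G X g a := by
  rw [isDefended_iff, isDefended_iff]
  constructor
  · rintro ⟨y, hy⟩
    rcases P.cases y with rfl | ⟨b, rfl⟩
    · have := hy.2.1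
      rw [extendZero_of_notMem g P.notMem] at this
      omega
    · refine ⟨b, ?_⟩
      have := P.defends_comp subset_rfl (Or.inl (extendZero_of_notMem g P.notMem)) hy
      simpa using this
  · rintro ⟨b, hb⟩
    exact ⟨φ b, P.defends_of_comp (fun p hp hp' => absurd hp hp') (by simpa using hb)⟩

/-- Minimum functions vanish on the new endvertex. -/
theorem LeafExt.apply_eq_zero_of_strong [Fintype W] (P : LeafExt G H φ u z) (hS : Strong H (φ '' X))
    {h : W → ℕ} (hh : IsMinWRDF H (φ '' X) h) : h z = 0 := by
  have h2 := hh.1.le_two z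
  by_contra h0
  -- Value 1 would make `z` demanded; value 2 would require a private neighbor besides `φ u`, the
  -- only neighbor of `z`.
  obtain h1 | h1 : h z = 1 ∨ h z = 2 := by omega
  · obtain ⟨⟨a, -, ha⟩, -⟩ := hh.of_eq_one (hS h hh) h1
    exact P.notMem ⟨a, ha⟩
  · obtain ⟨x, hx, hxu, -⟩ := hS.exists_isPrivate hh h1 (φ u) z
    exact hxu (P.eq_of_adj hx.2.1.symm)

variable [Fintype V] [Fintype W]

theorem LeafExt.weight_eq (P : LeafExt G H φ u z) (h : W → ℕ) :
    weight h = weight (h ∘ φ) + h z := by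
  classical
  rw [weight_eq_comp_add (φ := φ) h]
  have : Finset.univ.filter (fun x => x ∉ Set.range φ) = {z} := by
    ext x
    simp only [Finset.mem_filter, Finset.mem_univ, true_and, Finset.mem_singleton]
    exact ⟨P.eq_of_notMem x, by rintro rfl; exact P.notMem⟩
  rw [this, Finset.sum_singleton]

theorem LeafExt.weight_extendZero (P : LeafExt G H φ u z) (g : V → ℕ) :
    weight (extendZero φ g) = weight g := by
  rw [P.weight_eq, extendZero_comp, extendZero_of_notMem g P.notMem, add_zero]

theorem LeafExt.weight_pushLeaf (P : LeafExt G H φ u z) (h : W → ℕ) :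
    weight (pushLeaf φ u z h) + h (φ u) + h z = weight h + min 2 (h (φ u) + h z) := by
  classical
  have h1 := weight_update (h ∘ φ) u (min 2 (h (φ u) + h z))
  have h2 := P.weight_eq h
  have h3 : weight (pushLeaf φ u z h)
    = weight (Function.update (h ∘ φ) u (min 2 (h (φ u) + h z))) := by
    unfold pushLeaf; congr!
  simp only [Function.comp_apply] at h1
  omega

/-- Pushing units from the endvertex to `u` never raises the weight, so both graphs have the same
minimum. -/
theorem LeafExt.isMinWRDF_extendZero (P : LeafExt G H φ u z) {g : V → ℕ}
    (hg : IsMinWRDF G X g) : IsMinWRDF H (φ '' X) (extendZero φ g) := by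
  refine isMinWRDF_iff.2 ⟨P.isWRDF_extendZero hg.1, fun h hh => ?_⟩
  have h1 := hg.weight_le (P.isWRDF_pushLeaf hh)
  have h2 := P.weight_pushLeaf h
  have h3 := P.weight_extendZero g
  omega

/-- If more than two units met at `u`, the truncated function would be lighter than the common
minimum. -/
theorem LeafExt.isMinWRDF_pushLeaf (P : LeafExt G H φ u z) {h : W → ℕ}
    (hh : IsMinWRDF H (φ '' X) h) :
    IsMinWRDF G X (pushLeaf φ u z h) ∧ h (φ u) + h z ≤ 2 := by
  obtain ⟨g, hg⟩ := exists_isMinWRDF G X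
  have h1 := hh.weight_le (P.isWRDF_extendZero hg.1)
  have h2 := P.weight_pushLeaf h
  have h3 := P.weight_extendZero g
  have h4 := hg.weight_le (P.isWRDF_pushLeaf hh.1)
  exact ⟨hg.of_weight_le (P.isWRDF_pushLeaf hh.1) (by omega), by omega⟩

theorem LeafExt.isMinWRDF_comp (P : LeafExt G H φ u z) {h : W → ℕ}
    (hh : IsMinWRDF H (φ '' X) h) (hz : h z = 0) : IsMinWRDF G X (h ∘ φ) := by
  have h1 := (P.isMinWRDF_pushLeaf hh).1
  have : pushLeaf φ u z h = h ∘ φ := by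
    ext a
    rcases eq_or_ne a u with rfl | ha
    · rw [pushLeaf_self, hz]; have := hh.1.le_two (φ a); simp; omega
    · rw [pushLeaf_of_ne h ha]; rfl
  rwa [this] at h1

/-- Minimum functions vanish on the new endvertex. -/
theorem LeafExt.apply_eq_zero (P : LeafExt G H φ u z) (hS : Strong G X)
    (hT : ∀ a b c, G.Adj a b → G.Adj a c → ¬ G.Adj b c)
    (hu : ∀ g, IsMinWRDF G X g → g u ≠ 1) {h : W → ℕ} (hh : IsMinWRDF H (φ '' X) h) : h z = 0 := by
  by_contra h0
  obtain ⟨hg, hle⟩ := P.isMinWRDF_pushLeaf hh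
  have h1 := hu _ hg
  have h2 := pushLeaf_self (φ := φ) (u := u) (z := z) h
  have hg2 : pushLeaf φ u z h u = 2 := by omega
  -- As `h z` is positive, `h (φ u)` is at most 1. Under `h`, the private neighbor `a` can be
  -- defended only from `φ u`, which is left empty; a second private neighbor `b`, not adjacent to
  -- `a`, is then undominated.
  obtain ⟨a, ha, -, -⟩ := hS.exists_isPrivate hg hg2 u u
  obtain ⟨b, hb, hba, -⟩ := hS.exists_isPrivate hg hg2 a a
  have hzero : ∀ x, x ≠ u → pushLeaf φ u z h x = 0 → h (φ x) = 0 := fun x hx h => by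
    rwa [pushLeaf_of_ne _ hx] at h
  obtain ⟨y, hay, hy1, hd⟩ := isDefended_iff.1
    (hh.1.2 (φ a) ⟨a, ha.1, rfl⟩ (hzero a ha.2.1.ne ha.2.2.1))
  obtain rfl : y = φ u := by
    rcases P.cases y with rfl | ⟨y, rfl⟩
    · exact absurd ((P.cross a y P.notMem).1 hay).1 ha.2.1.ne
    · by_contra hne
      have hyu : y ≠ u := fun h => hne (h ▸ rfl)
      have := hzero y hyu (ha.2.2.2 y ((P.adj_iff _ _).1 hay) hyu)
      omega
  obtain ⟨y, hby, hy⟩ := hd (φ b) ⟨b, hb.1, rfl⟩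
  rcases P.cases y with rfl | ⟨y, rfl⟩
  · rcases hby with h | h
    · exact P.notMem ⟨b, h.symm⟩
    · exact absurd ((P.cross b y P.notMem).1 h).1 hb.2.1.ne
  rw [P.adj_iff, φ.injective.eq_iff] at hby
  rw [φ.injective.eq_iff, φ.injective.eq_iff] at hy
  rcases hy with rfl | ⟨hy, hyu⟩
  · rcases hby with h | h
    · exact hba h.symm
    · exact hT u y b ha.2.1.symm hb.2.1.symm h.symm
  · by_cases hyu' : y = u
    · have := hyu hyu'
      omega
    · rcases hby with rfl | h
      · have := hzero y hyu' hb.2.2.1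
        omega
      · have := hzero y hyu' (hb.2.2.2 y h hyu')
        omega

/-- Minimum functions vanish on the endvertex, hence extend minimum functions of `G` by zero. -/
theorem LeafExt.strong (P : LeafExt G H φ u z) (hS : Strong G X)
    (hT : ∀ a b c, G.Adj a b → G.Adj a c → ¬ G.Adj b c)
    (hu : ∀ g, IsMinWRDF G X g → g u ≠ 1) : Strong H (φ '' X) := by
  intro h hh
  have hz := P.apply_eq_zero hS hT hu hh
  rw [P.eq_extendZero hz, P.isRDF_extendZero]
  exact hS _ (P.isMinWRDF_comp hh hz)

theorem LeafExt.strong_of_strong (P : LeafExt G H φ u z) (hS : Strong H (φ '' X)) : Strong G X :=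
  fun _ hg => P.isRDF_extendZero.1 (hS _ (P.isMinWRDF_extendZero hg))

/-- A single unit at `u` could be moved to the endvertex at equal weight. Then `u` is defended from
there, but sees no 2 by `IsMinWRDF.of_eq_one`, contradicting strength. -/
theorem LeafExt.apply_ne_one (P : LeafExt G H φ u z) (hS : Strong H (φ '' X)) {g : V → ℕ}
    (hg : IsMinWRDF G X g) : g u ≠ 1 := by
  classical
  intro hu
  have hR := P.strong_of_strong hS g hg
  obtain ⟨huX, hu2⟩ := hg.of_eq_one hR hu
  set h : W → ℕ := Function.update (Function.update (extendZero φ g) (φ u) 0) z 1 with hdef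
  have hne : φ u ≠ z := P.adj.ne
  have hz : h z = 1 := by simp [hdef]
  have hφu : h (φ u) = 0 := by rw [hdef, Function.update_of_ne hne]; simp
  have ho : ∀ a, a ≠ u → h (φ a) = g a := fun a ha => by
    rw [hdef, Function.update_of_ne (fun h => P.notMem ⟨a, h⟩),
      Function.update_of_ne (fun h => ha (φ.injective h)), extendZero_apply]
  have hw1 := weight_update (extendZero φ g) (φ u) 0
  have hw2 : weight h + _ = _ := weight_update (Function.update (extendZero φ g) (φ u) 0) z 1
  rw [Function.update_of_ne hne.symm, extendZero_of_notMem g P.notMem] at hw2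
  rw [extendZero_apply] at hw1
  have two : ∀ q ∈ X, q ≠ u → g q = 0 → ∃ y, G.Adj q y ∧ h (φ y) = 2 := fun q hq hqu hq0 => by
    obtain ⟨y, hy, hy2⟩ := hR.2 q hq hq0
    refine ⟨y, hy, ?_⟩
    rw [ho y (by rintro rfl; omega), hy2]
  have hdom : ∀ q ∈ φ '' X, 1 ≤ h q ∨ ∃ y, H.Adj q y ∧ 1 ≤ h y := by
    rintro _ ⟨q, hq, rfl⟩
    by_cases hqu : q = u
    · subst hqu
      exact Or.inr ⟨z, P.adj, hz.ge⟩
    · by_cases hq0 : g q = 0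
      · obtain ⟨y, hy, hy2⟩ := two q hq hqu hq0
        exact Or.inr ⟨φ y, (P.adj_iff _ _).2 hy, by omega⟩
      · exact Or.inl (by rw [ho q hqu]; omega)
  have hW : IsWRDF H (φ '' X) h := by
    refine ⟨fun x => mem_values_iff.2 ?_, ?_⟩
    · rcases P.cases x with rfl | ⟨a, rfl⟩
      · omega
      · by_cases ha : a = u
        · subst ha; omega
        · rw [ho a ha]; exact hg.1.le_two a
    · rintro _ ⟨x, hx, rfl⟩ hx0
      by_cases hxu : x = u
      · subst hxu
        refine isDefended_iff.2 ⟨z, P.adj, hz.ge, ?_⟩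
        rintro _ ⟨q, hq, rfl⟩
        by_cases hqu : q = x
        · exact ⟨φ q, Or.inl rfl, Or.inl (by rw [hqu])⟩
        · by_cases hq0 : g q = 0
          · obtain ⟨y, hy, hy2⟩ := two q hq hqu hq0
            exact ⟨φ y, Or.inr ((P.adj_iff _ _).2 hy),
              Or.inr ⟨by omega, fun h => absurd ⟨y, h⟩ P.notMem⟩⟩
          · exact ⟨φ q, Or.inl rfl,
              Or.inr ⟨by rw [ho q hqu]; omega, fun h => absurd ⟨q, h⟩ P.notMem⟩⟩
      · rw [ho x hxu] at hx0
        obtain ⟨y, hy, hy2⟩ := two x hx hxu hx0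
        exact isDefended_of_adj_two ((P.adj_iff _ _).2 hy) hy2 hdom
  have hmin := (P.isMinWRDF_extendZero hg).of_weight_le hW (by omega)
  obtain ⟨y, hy, hy2⟩ := (hS h hmin).2 (φ u) ⟨u, huX, rfl⟩ hφu
  rcases P.cases y with rfl | ⟨y, rfl⟩
  · omega
  · have hadj := (P.adj_iff _ _).1 hy
    rw [ho y hadj.ne'] at hy2
    exact hu2 y hadj hy2

theorem LeafExt.apply_mem_coverable_iff (P : LeafExt G H φ u z) (hS : Strong H (φ '' X)) (a : V) :
    φ a ∈ coverable H (φ '' X) ↔ a ∈ coverable G X := by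
  constructor
  · rintro ⟨h, hh, hc⟩
    have hz := P.apply_eq_zero_of_strong hS hh
    refine ⟨h ∘ φ, P.isMinWRDF_comp hh hz, ?_⟩
    rw [P.eq_extendZero hz, P.defends_extendZero] at hc
    simpa using hc
  · rintro ⟨g, hg, hc⟩
    refine ⟨extendZero φ g, P.isMinWRDF_extendZero hg, ?_⟩
    rw [P.defends_extendZero]
    simpa using hc

/-- The endvertex has value 0 and can be defended only from `u`, whose value is never 1. -/
theorem LeafExt.new_mem_coverable_iff (P : LeafExt G H φ u z) (hS : Strong H (φ '' X)) :
    z ∈ coverable H (φ '' X) ↔ ∃ g, IsMinWRDF G X g ∧ g u = 2 := by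
  constructor
  · rintro ⟨h, hh, hc⟩
    have hz := P.apply_eq_zero_of_strong hS hh
    have hg := P.isMinWRDF_comp hh hz
    refine ⟨h ∘ φ, hg, ?_⟩
    rcases hc with hc | ⟨-, hc⟩
    · omega
    · obtain ⟨y, hzy, hy, -⟩ := isDefended_iff.1 hc
      obtain rfl := P.eq_of_adj hzy
      have h1 := P.apply_ne_one hS hg
      have h2 := hg.1.le_two u
      simp only [Function.comp_apply] at h1 h2 ⊢
      omega
  · rintro ⟨g, hg, hu⟩
    exact mem_coverable_of_adj_two (P.isMinWRDF_extendZero hg) P.adj.symm (by simpa using hu)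

theorem LeafExt.coverable_eq_of_never_two (P : LeafExt G H φ u z) (hS : Strong H (φ '' X))
    (hu : ∀ g, IsMinWRDF G X g → g u ≠ 2) : coverable H (φ '' X) = φ '' coverable G X := by
  ext x
  rcases P.cases x with rfl | ⟨a, rfl⟩
  · rw [P.new_mem_coverable_iff hS]
    refine iff_of_false (fun ⟨g, hg, h⟩ => hu g hg h) ?_
    rintro ⟨a, -, ha⟩
    exact P.notMem ⟨a, ha⟩
  · rw [P.apply_mem_coverable_iff hS, φ.injective.mem_set_image]

theorem LeafExt.coverable_eq_of_two (P : LeafExt G H φ u z) (hS : Strong H (φ '' X))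
    (hu : ∃ g, IsMinWRDF G X g ∧ g u = 2) : coverable H (φ '' X) = φ '' coverable G X ∪ {z} := by
  ext x
  rcases P.cases x with rfl | ⟨a, rfl⟩
  · rw [P.new_mem_coverable_iff hS]
    exact iff_of_true hu (Or.inr rfl)
  · rw [P.apply_mem_coverable_iff hS, Set.mem_union, φ.injective.mem_set_image]
    have : φ a ≠ z := fun h => P.notMem ⟨a, h⟩
    simp [this]

end Leaf

/-! ### Adding a demand next to a constant 2 -/

section AddVertex

variable {V : Type u} [Fintype V] {G : SimpleGraph V} {X : Set V} {p v : V}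

/-- A neighbor of a vertex that always has value `2` can be added to `X`. -/
theorem isMinWRDF_insert_iff (hpv : G.Adj p v)
    (hv : ∀ g, IsMinWRDF G X g → g v = 2) {g : V → ℕ} :
    IsMinWRDF G (X ∪ {p}) g ↔ IsMinWRDF G X g := by
  have mono : ∀ g, IsWRDF G (X ∪ {p}) g → IsWRDF G X g := fun g hg => by
    refine ⟨hg.1, fun x hx hx0 => ?_⟩
    obtain ⟨y, h1, h2, h3⟩ := isDefended_iff.1 (hg.2 x (Or.inl hx) hx0)
    exact isDefended_iff.2 ⟨y, h1, h2, fun q hq => h3 q (Or.inl hq)⟩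
  -- With value 2, `v` dominates `p` even after giving a unit away, so the extra demand is free.
  have lift : ∀ g, IsMinWRDF G X g → IsWRDF G (X ∪ {p}) g := fun g hg => by
    have hv2 := hv g hg
    refine ⟨hg.1.1, fun x hx hx0 => ?_⟩
    by_cases hxX : x ∈ X
    · obtain ⟨y, h1, h2, h3⟩ := isDefended_iff.1 (hg.1.2 x hxX hx0)
      refine isDefended_iff.2 ⟨y, h1, h2, ?_⟩
      rintro q (hq | rfl)
      · exact h3 q hq
      · exact ⟨v, Or.inr hpv, Or.inr ⟨by omega, by rintro rfl; omega⟩⟩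
    · obtain rfl : x = p := by simpa [hxX] using hx
      refine isDefended_of_adj_two hpv hv2 ?_
      rintro q (hq | rfl)
      · exact hg.1.dominates hq
      · exact Or.inr ⟨v, hpv, by omega⟩
  constructor
  · intro hg
    obtain ⟨k, hk⟩ := exists_isMinWRDF G X
    exact hk.of_weight_le (mono g hg.1) (hg.weight_le (lift k hk))
  · intro hg
    exact isMinWRDF_iff.2 ⟨lift g hg, fun k hk => hg.weight_le (mono k hk)⟩

theorem Strong.insert (hS : Strong G X) (hpv : G.Adj p v)
    (hv : ∀ g, IsMinWRDF G X g → g v = 2) : Strong G (X ∪ {p}) := by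
  intro g hg
  rw [isMinWRDF_insert_iff hpv hv] at hg
  refine ⟨hg.1.1, ?_⟩
  rintro x (hx | rfl) hx0
  · exact (hS g hg).2 x hx hx0
  · exact ⟨v, hpv, hv g hg⟩

theorem coverable_insert (hpv : G.Adj p v)
    (hv : ∀ g, IsMinWRDF G X g → g v = 2) : coverable G (X ∪ {p}) = coverable G X := by
  ext x
  refine exists_congr fun g => ?_
  rw [isMinWRDF_insert_iff hpv hv]
  refine and_congr_right fun hg => or_congr_right (and_congr_right fun _ => ?_)
  rw [isDefended_iff, isDefended_iff]
  refine exists_congr fun y => ⟨fun h => ⟨h.1, h.2.1, fun q hq => h.2.2 q (Or.inl hq)⟩,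
    fun h => ⟨h.1, h.2.1, ?_⟩⟩
  rintro q (hq | rfl)
  · exact h.2.2 q hq
  · have := hv g hg
    exact ⟨v, Or.inr hpv, Or.inr ⟨by omega, by rintro rfl; omega⟩⟩

end AddVertex

/-! ### Attaching a star -/

section Star

variable {V W : Type u} {G : SimpleGraph V} {H : SimpleGraph W} {φ : V ↪ W} {u : V} {v : W}
  {X : Set V} {X' : Set W}

/-- `H` arises from `G` by attaching the center `v` of a star to `u`. -/
structure StarExt (G : SimpleGraph V) (H : SimpleGraph W) (φ : V ↪ W) (u : V) (v : W) : Prop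
    extends PendantExt G H φ u v where
  adj_center : ∀ x, x ∉ Set.range φ → x ≠ v → H.Adj x v
  not_adj : ∀ x y, x ∉ Set.range φ → x ≠ v → y ∉ Set.range φ → y ≠ v → ¬ H.Adj x y

theorem StarExt.eq_of_adj (P : StarExt G H φ u v) {x y : W} (hx : x ∉ Set.range φ) (hxv : x ≠ v)
    (h : H.Adj x y) : y = v := by
  by_contra hy
  by_cases hyr : y ∈ Set.range φ
  · obtain ⟨b, rfl⟩ := hyr
    exact hxv ((P.cross b x hx).1 h.symm).2
  · exact P.not_adj x y hx hxv hyr hy h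

/-- `w` is an endvertex of the attached star that belongs to `X'`. -/
def IsDemandingLeaf (φ : V ↪ W) (v : W) (X' : Set W) (w : W) : Prop :=
  w ∉ Set.range φ ∧ w ≠ v ∧ w ∈ X'

theorem StarExt.one_le_center (P : StarExt G H φ u v) {h : W → ℕ} (hh : IsWRDF H X' h) {w : W}
    (hw : IsDemandingLeaf φ v X' w) (h0 : h w = 0) : 1 ≤ h v := by
  obtain ⟨y, hy, hy1, -⟩ := isDefended_iff.1 (hh.2 w hw.2.2 h0)
  rwa [P.eq_of_adj hw.1 hw.2.1 hy] at hy1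

/-- A zero leaf that is not itself being defended relies on the center after the center has donated.
-/
theorem StarExt.two_le_center_of_defends (P : StarExt G H φ u v) {h : W → ℕ} {x w : W}
    (hd : Defends H X' h x v) (hw : IsDemandingLeaf φ v X' w) (h0 : h w = 0) (hxw : x ≠ w) :
    2 ≤ h v := by
  obtain ⟨y, hy, hy'⟩ := hd.2.2 w hw.2.2
  have hxv := hd.1.ne
  rcases hy with rfl | hy
  · rcases hy' with rfl | hy'
    · exact absurd rfl hxw
    · omega
  · obtain rfl := P.eq_of_adj hw.1 hw.2.1 hy
    rcases hy' with h | h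
    · exact absurd h.symm hxv
    · exact h.2 rfl

theorem StarExt.two_le_center (P : StarExt G H φ u v) {h : W → ℕ} (hh : IsWRDF H X' h) {w w' : W}
    (hw : IsDemandingLeaf φ v X' w) (hw' : IsDemandingLeaf φ v X' w') (hne : w ≠ w')
    (h0 : h w = 0) (h0' : h w' = 0) : 2 ≤ h v := by
  obtain ⟨y, hy⟩ := isDefended_iff.1 (hh.2 w hw.2.2 h0)
  obtain rfl := P.eq_of_adj hw.1 hw.2.1 hy.1
  exact P.two_le_center_of_defends hy hw' h0' hne

open scoped Classical in
/-- Extension of a function by the value `2` at the center of the attached star. -/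
noncomputable def extendStar (φ : V ↪ W) (v : W) (g : V → ℕ) : W → ℕ :=
  Function.update (extendZero φ g) v 2

@[simp] theorem extendStar_center (g : V → ℕ) : extendStar φ v g v = 2 := by simp [extendStar]

theorem StarExt.extendStar_apply (P : StarExt G H φ u v) (g : V → ℕ) (a : V) :
    extendStar φ v g (φ a) = g a := by
  classical
  rw [extendStar, Function.update_of_ne (fun h => P.notMem ⟨a, h⟩), extendZero_apply]

theorem extendStar_leaf (g : V → ℕ) {x : W} (hx : x ∉ Set.range φ) (hxv : x ≠ v) :
    extendStar φ v g x = 0 := by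
  classical
  rw [extendStar, Function.update_of_ne hxv, extendZero_of_notMem g hx]

theorem StarExt.extendStar_comp (P : StarExt G H φ u v) (g : V → ℕ) :
    extendStar φ v g ∘ φ = g := by
  ext a; exact P.extendStar_apply g a

theorem StarExt.extendStar_mem (P : StarExt G H φ u v) {g : V → ℕ}
    (h : ∀ a, g a ∈ ({0, 1, 2} : Set ℕ)) (x : W) : extendStar φ v g x ∈ ({0, 1, 2} : Set ℕ) := by
  by_cases hx : x ∈ Set.range φ
  · obtain ⟨a, rfl⟩ := hx
    rw [P.extendStar_apply]; exact h a
  · by_cases hxv : x = v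
    · subst hxv; simp
    · rw [extendStar_leaf g hx hxv]; simp

/-- The sets of demands of `G` and `H` agree away from `u` and the attached star. -/
structure DemandExt (φ : V ↪ W) (u : V) (X : Set V) (X' : Set W) : Prop where
  image_subset : φ '' X ⊆ X'
  subset : X' ⊆ φ '' X ∪ {φ u} ∪ (Set.range φ)ᶜ
  notMem : u ∉ X

theorem StarExt.dominated (P : StarExt G H φ u v) (D : DemandExt φ u X X') {p : W} (hp : p ∈ X')
    (hpX : p ∉ φ '' X) : p = v ∨ H.Adj p v := by
  rcases D.subset hp with (h | h) | h
  · exact absurd h hpX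
  · rw [Set.mem_singleton_iff.1 h]
    exact Or.inr P.adj
  · by_cases hpv : p = v
    · exact Or.inl hpv
    · exact Or.inr (P.adj_center p h hpv)

theorem StarExt.isWRDF_extendStar (P : StarExt G H φ u v) (D : DemandExt φ u X X') {g : V → ℕ}
    (hg : IsWRDF G X g) : IsWRDF H X' (extendStar φ v g) := by
  refine ⟨P.extendStar_mem hg.1, fun x hx hx0 => ?_⟩
  by_cases hxX : x ∈ φ '' X
  · obtain ⟨x, hxX, rfl⟩ := hxX
    rw [P.extendStar_apply] at hx0
    obtain ⟨b, hb⟩ := isDefended_iff.1 (hg.2 x hxX hx0)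
    refine isDefended_iff.2 ⟨φ b, P.defends_of_comp (fun p hp hp' => ⟨v, ?_, by simp, by simp⟩)
      (by rwa [P.extendStar_comp])⟩
    rcases P.dominated D hp hp' with h | h
    · exact Or.inl h.symm
    · exact Or.inr h
  · have hxv : H.Adj x v := by
      rcases P.dominated D hx hxX with rfl | h
      · simp at hx0
      · exact h
    refine isDefended_of_adj_two hxv (by simp) fun q hq => ?_
    by_cases hqX : q ∈ φ '' X
    · obtain ⟨q, hqX, rfl⟩ := hqX
      rcases hg.dominates hqX with h | ⟨y, hy, h⟩
      · exact Or.inl (by rwa [P.extendStar_apply])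
      · exact Or.inr ⟨φ y, (P.adj_iff _ _).2 hy, by rwa [P.extendStar_apply]⟩
    · rcases P.dominated D hq hqX with rfl | h
      · simp
      · exact Or.inr ⟨v, h, by simp⟩

/-- The star touches the old graph only at `u`, which is undemanded in `X`, so it cannot help there.
-/
theorem StarExt.isWRDF_comp (P : StarExt G H φ u v) (D : DemandExt φ u X X') {h : W → ℕ}
    (hh : IsWRDF H X' h) : IsWRDF G X (h ∘ φ) := by
  refine ⟨fun a => hh.1 _, fun x hx hx0 => ?_⟩
  obtain ⟨y, hy⟩ := isDefended_iff.1 (hh.2 (φ x) (D.image_subset ⟨x, hx, rfl⟩) hx0)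
  by_cases hyr : y ∈ Set.range φ
  · obtain ⟨b, rfl⟩ := hyr
    exact isDefended_iff.2 ⟨b, P.defends_comp D.image_subset (Or.inr D.notMem) hy⟩
  · obtain ⟨rfl, -⟩ := (P.cross x y hyr).1 hy.1
    exact absurd hx D.notMem

theorem StarExt.isRDF_extendStar (P : StarExt G H φ u v) (D : DemandExt φ u X X') {g : V → ℕ} :
    IsRDF H X' (extendStar φ v g) ↔ IsRDF G X g := by
  constructor
  · intro h
    refine ⟨fun a => by simpa [P.extendStar_apply] using h.1 (φ a), fun x hx hx0 => ?_⟩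
    obtain ⟨y, hy, hy2⟩ := h.2 (φ x) (D.image_subset ⟨x, hx, rfl⟩)
      (by rwa [P.extendStar_apply])
    by_cases hyr : y ∈ Set.range φ
    · obtain ⟨b, rfl⟩ := hyr
      exact ⟨b, (P.adj_iff _ _).1 hy, by rwa [P.extendStar_apply] at hy2⟩
    · obtain ⟨rfl, -⟩ := (P.cross x y hyr).1 hy
      exact absurd hx D.notMem
  · intro h
    refine ⟨P.extendStar_mem h.1, fun x hx hx0 => ?_⟩
    by_cases hxX : x ∈ φ '' X
    · obtain ⟨x, hxX, rfl⟩ := hxX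
      obtain ⟨y, hy, hy2⟩ := h.2 x hxX (by rwa [P.extendStar_apply] at hx0)
      exact ⟨φ y, (P.adj_iff _ _).2 hy, by rwa [P.extendStar_apply]⟩
    · rcases P.dominated D hx hxX with rfl | h
      · simp at hx0
      · exact ⟨v, h, by simp⟩

variable [Fintype V] [Fintype W]

open scoped Classical in
theorem StarExt.weight_extendStar (P : StarExt G H φ u v) (g : V → ℕ) :
    weight (extendStar φ v g) = weight g + 2 := by
  rw [weight_eq_comp_add (φ := φ), P.extendStar_comp, Finset.sum_eq_single_of_mem v]
  · simp
  · simpa using P.notMem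
  · intro b hb hbv
    rw [Finset.mem_filter] at hb
    exact extendStar_leaf g hb.2 hbv

theorem weight_comp_add_sum_le (h : W → ℕ) (s : Finset W) (hs : ∀ x ∈ s, x ∉ Set.range φ) :
    weight (h ∘ φ) + ∑ x ∈ s, h x ≤ weight h := by
  classical
  rw [weight_eq_comp_add (φ := φ) h]
  gcongr
  intro x hx
  simpa using hs x hx

open scoped Classical in
theorem StarExt.weight_add_le (P : StarExt G H φ u v) (h : W → ℕ) {w w' : W} (hw : w ∉ Set.range φ)
    (hw' : w' ∉ Set.range φ) (hwv : w ≠ v) (hwv' : w' ≠ v) (hne : w ≠ w') :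
    weight (h ∘ φ) + (h v + (h w + h w')) ≤ weight h := by
  have h1 := weight_comp_add_sum_le (φ := φ) h {v, w, w'} (by
    rintro x hx
    simp only [Finset.mem_insert, Finset.mem_singleton] at hx
    rcases hx with rfl | rfl | rfl
    exacts [P.notMem, hw, hw'])
  rwa [Finset.sum_insert (by simp [hwv.symm, hwv'.symm]), Finset.sum_insert (by simpa using hne),
    Finset.sum_singleton] at h1

open scoped Classical in
theorem StarExt.weight_add_le_three (P : StarExt G H φ u v) (h : W → ℕ) {w₁ w₂ w₃ : W}
    (h₁ : w₁ ∉ Set.range φ) (h₂ : w₂ ∉ Set.range φ) (h₃ : w₃ ∉ Set.range φ) (h₁v : w₁ ≠ v)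
    (h₂v : w₂ ≠ v) (h₃v : w₃ ≠ v) (h12 : w₁ ≠ w₂) (h13 : w₁ ≠ w₃) (h23 : w₂ ≠ w₃) :
    weight (h ∘ φ) + (h v + (h w₁ + (h w₂ + h w₃))) ≤ weight h := by
  have h1 := weight_comp_add_sum_le (φ := φ) h {v, w₁, w₂, w₃} (by
    rintro x hx
    simp only [Finset.mem_insert, Finset.mem_singleton] at hx
    rcases hx with rfl | rfl | rfl | rfl
    exacts [P.notMem, h₁, h₂, h₃])
  rwa [Finset.sum_insert (by simp [h₁v.symm, h₂v.symm, h₃v.symm]),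
    Finset.sum_insert (by simp [h12, h13]), Finset.sum_insert (by simpa using h23),
    Finset.sum_singleton] at h1

open scoped Classical in
theorem StarExt.weight_add_le' (P : StarExt G H φ u v) (h : W → ℕ) {w : W} (hw : w ∉ Set.range φ)
    (hwv : w ≠ v) : weight (h ∘ φ) + (h v + h w) ≤ weight h := by
  have h1 := weight_comp_add_sum_le (φ := φ) h {v, w} (by
    rintro x hx
    simp only [Finset.mem_insert, Finset.mem_singleton] at hx
    rcases hx with rfl | rfl
    exacts [P.notMem, hw])
  rwa [Finset.sum_insert (by simp [hwv.symm]), Finset.sum_singleton] at h1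

/-- Two zero leaves force 2 at the center; one zero leaf forces 1 there, beside the other, positive
leaf; otherwise both leaves are positive. -/
theorem StarExt.weight_comp_add_two_le (P : StarExt G H φ u v) {h : W → ℕ} (hh : IsWRDF H X' h)
    {w w' : W} (hw : IsDemandingLeaf φ v X' w) (hw' : IsDemandingLeaf φ v X' w') (hne : w ≠ w') :
    weight (h ∘ φ) + 2 ≤ weight h := by
  have h1 := P.weight_add_le h hw.1 hw'.1 hw.2.1 hw'.2.1 hne
  have h2 := P.one_le_center hh hw
  have h3 := P.one_le_center hh hw'
  have h4 := P.two_le_center hh hw hw' hne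
  omega

section

variable {w w' : W}

theorem StarExt.isMinWRDF_extendStar (P : StarExt G H φ u v) (D : DemandExt φ u X X')
    (hw : IsDemandingLeaf φ v X' w) (hw' : IsDemandingLeaf φ v X' w') (hne : w ≠ w') {g : V → ℕ}
    (hg : IsMinWRDF G X g) : IsMinWRDF H X' (extendStar φ v g) := by
  refine isMinWRDF_iff.2 ⟨P.isWRDF_extendStar D hg.1, fun h hh => ?_⟩
  have h1 := P.weight_comp_add_two_le hh hw hw' hne
  have h2 := hg.weight_le (P.isWRDF_comp D hh)
  have h3 := P.weight_extendStar g
  omega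

/-- The value 2 at the center attains the lower bound for the star, so no minimum function spends
more there. -/
theorem StarExt.isMinWRDF_comp (P : StarExt G H φ u v) (D : DemandExt φ u X X')
    (hw : IsDemandingLeaf φ v X' w) (hw' : IsDemandingLeaf φ v X' w') (hne : w ≠ w') {h : W → ℕ}
    (hh : IsMinWRDF H X' h) : IsMinWRDF G X (h ∘ φ) ∧ weight h = weight (h ∘ φ) + 2 := by
  obtain ⟨g, hg⟩ := exists_isMinWRDF G X
  have h1 := P.weight_comp_add_two_le hh.1 hw hw' hne
  have h2 := hh.weight_le (P.isWRDF_extendStar D hg.1)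
  have h3 := P.weight_extendStar g
  have h4 := hg.weight_le (P.isWRDF_comp D hh.1)
  exact ⟨hg.of_weight_le (P.isWRDF_comp D hh.1) (by omega), by omega⟩

theorem StarExt.strong_of_strong (P : StarExt G H φ u v) (D : DemandExt φ u X X')
    (hw : IsDemandingLeaf φ v X' w) (hw' : IsDemandingLeaf φ v X' w') (hne : w ≠ w')
    (hS : Strong H X') : Strong G X := fun _ hg =>
  (P.isRDF_extendStar D).1 (hS _ (P.isMinWRDF_extendStar D hw hw' hne hg))

theorem StarExt.eq_extendStar (P : StarExt G H φ u v) (D : DemandExt φ u X X')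
    (hw : IsDemandingLeaf φ v X' w) (hw' : IsDemandingLeaf φ v X' w') (hne : w ≠ w') {h : W → ℕ}
    (hh : IsMinWRDF H X' h) (hv : h v = 2) : h = extendStar φ v (h ∘ φ) := by
  ext x
  by_cases hx : x ∈ Set.range φ
  · obtain ⟨a, rfl⟩ := hx
    rw [P.extendStar_apply]; rfl
  · by_cases hxv : x = v
    · subst hxv; simpa using hv
    · rw [extendStar_leaf _ hx hxv]
      have h1 := P.weight_add_le' h hx hxv
      have h2 := (P.isMinWRDF_comp D hw hw' hne hh).2
      omega

theorem StarExt.strong (P : StarExt G H φ u v) (D : DemandExt φ u X X')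
    (hw : IsDemandingLeaf φ v X' w) (hw' : IsDemandingLeaf φ v X' w') (hne : w ≠ w')
    (hv : ∀ h, IsMinWRDF H X' h → h v = 2) (hS : Strong G X) : Strong H X' := by
  intro h hh
  rw [P.eq_extendStar D hw hw' hne hh (hv h hh), P.isRDF_extendStar D]
  exact hS _ (P.isMinWRDF_comp D hw hw' hne hh).1

/-- Minimum functions of `H` are those of `G` extended by 2 at the center. This covers `u` and the
star, and the other old vertices are defended in `H` exactly when they are in `G`. -/
theorem StarExt.coverable_eq (P : StarExt G H φ u v) (D : DemandExt φ u X X')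
    (hw : IsDemandingLeaf φ v X' w) (hw' : IsDemandingLeaf φ v X' w') (hne : w ≠ w')
    (hv : ∀ h, IsMinWRDF H X' h → h v = 2) :
    coverable H X' = φ '' coverable G X ∪ {φ u} ∪ (Set.range φ)ᶜ := by
  obtain ⟨g, hg⟩ := exists_isMinWRDF G X
  have hadj : ∀ x, H.Adj x v → x ∈ coverable H X' := fun x hx =>
    mem_coverable_of_adj_two (P.isMinWRDF_extendStar D hw hw' hne hg) hx (by simp)
  ext x
  by_cases hx : x ∈ Set.range φ
  swap
  · refine iff_of_true ?_ (Or.inr hx)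
    by_cases hxv : x = v
    · exact ⟨_, P.isMinWRDF_extendStar D hw hw' hne hg, Or.inl (by simp [hxv])⟩
    · exact hadj x (P.adj_center x hx hxv)
  obtain ⟨a, rfl⟩ := hx
  by_cases hau : a = u
  · subst hau
    exact iff_of_true (hadj _ P.adj) (Or.inl (Or.inr rfl))
  have key : ∀ g : V → ℕ, IsDefended H X' (extendStar φ v g) (φ a) ↔ IsDefended G X g a := by
    intro g
    rw [isDefended_iff, isDefended_iff]
    constructor
    · rintro ⟨y, hy⟩
      by_cases hyr : y ∈ Set.range φ
      · obtain ⟨b, rfl⟩ := hyr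
        refine ⟨b, ?_⟩
        have := P.defends_comp D.image_subset (Or.inr D.notMem) hy
        rwa [P.extendStar_comp] at this
      · exact absurd ((P.cross a y hyr).1 hy.1).1 hau
    · rintro ⟨b, hb⟩
      refine ⟨φ b, P.defends_of_comp (fun p hp hp' => ⟨v, ?_, by simp, by simp⟩)
        (by rwa [P.extendStar_comp])⟩
      rcases P.dominated D hp hp' with h | h
      · exact Or.inl h.symm
      · exact Or.inr h
  have : φ a ∈ φ '' coverable G X ∪ {φ u} ∪ (Set.range φ)ᶜ ↔ a ∈ coverable G X := by
    simp [hau]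
  rw [this]
  constructor
  · rintro ⟨h, hh, hc⟩
    refine ⟨h ∘ φ, (P.isMinWRDF_comp D hw hw' hne hh).1, ?_⟩
    rw [P.eq_extendStar D hw hw' hne hh (hv h hh), key, P.extendStar_apply] at hc
    exact hc
  · rintro ⟨g, hg, hc⟩
    refine ⟨extendStar φ v g, P.isMinWRDF_extendStar D hw hw' hne hg, ?_⟩
    rwa [key, P.extendStar_apply]

/-- With three demanding leaves, the center always has value `2`. -/
theorem StarExt.center_eq_two_of_three (P : StarExt G H φ u v) (D : DemandExt φ u X X') {w₁ w₂ w₃ : W}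
    (h₁ : IsDemandingLeaf φ v X' w₁) (h₂ : IsDemandingLeaf φ v X' w₂)
    (h₃ : IsDemandingLeaf φ v X' w₃) (h12 : w₁ ≠ w₂) (h13 : w₁ ≠ w₃) (h23 : w₂ ≠ w₃) {h : W → ℕ}
    (hh : IsMinWRDF H X' h) : h v = 2 := by
  -- The star has budget 2. With at most 1 at the center, at most one leaf is zero, and then the
  -- center is positive; either way the star would cost 3.
  have a := (P.isMinWRDF_comp D h₁ h₂ h12 hh).2
  have b := P.weight_add_le_three h h₁.1 h₂.1 h₃.1 h₁.2.1 h₂.2.1 h₃.2.1 h12 h13 h23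
  have c1 := P.one_le_center hh.1 h₁
  have c2 := P.one_le_center hh.1 h₂
  have c3 := P.one_le_center hh.1 h₃
  have d1 := P.two_le_center hh.1 h₁ h₂ h12
  have d2 := P.two_le_center hh.1 h₁ h₃ h13
  have d3 := P.two_le_center hh.1 h₂ h₃ h23
  have := hh.1.le_two v
  omega

/-- With two demanding leaves, the center always has value `2` if its neighbor outside the star
also has to be covered by the star. -/
theorem StarExt.center_eq_two_of_two (P : StarExt G H φ u v) (D : DemandExt φ u X X')
    (hw : IsDemandingLeaf φ v X' w) (hw' : IsDemandingLeaf φ v X' w') (hne : w ≠ w')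
    (hu : φ u ∈ X') (huY : u ∉ coverable G X) {h : W → ℕ} (hh : IsMinWRDF H X' h) : h v = 2 := by
  obtain ⟨hg, a⟩ := P.isMinWRDF_comp D hw hw' hne hh
  -- Since `u` is not coverable in `G`, it has value 0 and is defended by the center. If the center
  -- had value 1, both leaves would be positive, exceeding the budget of 2.
  by_cases hu0 : h (φ u) = 0
  swap
  · exact absurd ⟨h ∘ φ, hg, Or.inl (Nat.one_le_iff_ne_zero.2 hu0)⟩ huY
  obtain ⟨y, hy⟩ := isDefended_iff.1 (hh.1.2 _ hu hu0)
  have b := P.weight_add_le h hw.1 hw'.1 hw.2.1 hw'.2.1 hne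
  have c := hh.1.le_two v
  by_cases hyr : y ∈ Set.range φ
  · obtain ⟨b, rfl⟩ := hyr
    refine absurd ⟨h ∘ φ, hg, Or.inr ⟨hu0, ?_⟩⟩ huY
    exact isDefended_iff.2 ⟨b, P.defends_comp D.image_subset (Or.inr D.notMem) hy⟩
  · obtain ⟨-, rfl⟩ := (P.cross u y hyr).1 hy.1
    have d1 := P.two_le_center_of_defends hy hw
    have d2 := P.two_le_center_of_defends hy hw'
    have e1 : φ u ≠ w := fun h => hw.1 ⟨u, h⟩
    have e2 : φ u ≠ w' := fun h => hw'.1 ⟨u, h⟩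
    have f := hy.2.1
    by_cases h0 : h w = 0
    · have := d1 h0 e1
      omega
    · by_cases h0' : h w' = 0
      · have := d2 h0' e2
        omega
      · omega

/-- If the star has only two endvertices and `H` is strong, then `u` relies on the star. -/
theorem StarExt.notMem_coverable (P : StarExt G H φ u v) (D : DemandExt φ u X X')
    (hw : IsDemandingLeaf φ v X' w) (hw' : IsDemandingLeaf φ v X' w') (hne : w ≠ w')
    (hall : ∀ x, x ∉ Set.range φ → x = v ∨ x = w ∨ x = w') (hS : Strong H X') :
    φ u ∈ X' ∧ u ∉ coverable G X := by
  -- The center has a private neighbor other than the two leaves, which can only be `φ u`.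
  have key : ∀ g, IsMinWRDF G X g → IsPrivate H X' (extendStar φ v g) v (φ u) := by
    intro g hg
    obtain ⟨x, hx, h1, h2⟩ := hS.exists_isPrivate
      (P.isMinWRDF_extendStar D hw hw' hne hg) (extendStar_center g) w w'
    by_cases hxr : x ∈ Set.range φ
    · obtain ⟨a, rfl⟩ := hxr
      obtain ⟨rfl, -⟩ := (P.cross a v P.notMem).1 hx.2.1
      exact hx
    · rcases hall x hxr with rfl | rfl | rfl
      · exact absurd rfl hx.2.1.ne
      · exact absurd rfl h1
      · exact absurd rfl h2
  obtain ⟨g, hg⟩ := exists_isMinWRDF G X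
  refine ⟨(key g hg).1, ?_⟩
  rintro ⟨g, hg, hc⟩
  obtain ⟨-, -, h0, hN⟩ := key g hg
  rw [P.extendStar_apply] at h0
  rcases hc with hc | ⟨-, hc⟩
  · omega
  · obtain ⟨b, hb, hb1, -⟩ := isDefended_iff.1 hc
    have := hN (φ b) ((P.adj_iff _ _).2 hb) (fun h => P.notMem ⟨b, h⟩)
    rw [P.extendStar_apply] at this
    omega

end

end Star

/-! ### Branches of a forest -/

section Branch

variable {V : Type u} {T : SimpleGraph V} {u v w x y : V}

theorem mem_branch_self (h : w ≠ v) : w ∈ branch T v w :=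
  ⟨h, h, SimpleGraph.Reachable.refl _⟩

theorem ne_of_mem_branch (h : x ∈ branch T v w) : x ≠ v := h.2.1

theorem mem_branch_of_adj (h : x ∈ branch T v w) (hxy : T.Adj x y) (hy : y ≠ v) :
    y ∈ branch T v w := by
  obtain ⟨hw, hx, hr⟩ := h
  have : (T.induce ({v}ᶜ : Set V)).Adj ⟨x, hx⟩ ⟨y, hy⟩ := hxy
  exact ⟨hw, hy, hr.trans this.reachable⟩

/-- Serves as the induction principle for branches, along walks that avoid `v`. -/
theorem branch_subset {C : Set V} (hw : w ∈ C)
    (hC : ∀ x ∈ C, ∀ y, T.Adj x y → y ≠ v → y ∈ C) : branch T v w ⊆ C := by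
  rintro x ⟨hw', hx, ⟨p⟩⟩
  have : ∀ {a b : ({v}ᶜ : Set V)}, (T.induce ({v}ᶜ : Set V)).Walk a b → (a : V) ∈ C →
      (b : V) ∈ C := by
    intro a b p
    induction p with
    | nil => exact id
    | @cons a c b h p ih => exact fun ha => ih (hC a ha c h c.2)
  exact this p hw

/-- The edge `vw` is a bridge, and a second neighbor of `v` in the branch would give a detour around
it. -/
theorem eq_of_mem_branch_of_adj (hT : T.IsAcyclic) (hvw : T.Adj v w) (hx : x ∈ branch T v w)
    (hvx : T.Adj v x) : x = w := by
  by_contra hne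
  have hb := (SimpleGraph.isAcyclic_iff_forall_adj_isBridge.1 hT) hvw
  rw [SimpleGraph.isBridge_iff] at hb
  apply hb
  have h1 : (T.deleteEdges {s(v, w)}).Adj v x := by
    rw [SimpleGraph.deleteEdges_adj]
    refine ⟨hvx, ?_⟩
    simp [hne, hvw.ne, hvx.ne.symm]
  have key : branch T v w ⊆ {y | (T.deleteEdges {s(v, w)}).Reachable y w} ∩ {v}ᶜ := by
    refine branch_subset ⟨SimpleGraph.Reachable.refl _, hvw.ne'⟩ ?_
    rintro a ⟨ha, hav⟩ b hab hbv
    refine ⟨SimpleGraph.Reachable.trans (SimpleGraph.Adj.reachable ?_) ha, hbv⟩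
    rw [SimpleGraph.deleteEdges_adj]
    refine ⟨hab.symm, ?_⟩
    simp only [Set.mem_compl_iff, Set.mem_singleton_iff] at hav
    simp [hbv, hav]
  exact h1.reachable.trans (key hx).1

theorem not_adj_of_adj_of_adj (hT : T.IsAcyclic) (a b c : V) (hab : T.Adj a b) (hac : T.Adj a c) :
    ¬ T.Adj b c := fun hbc =>
  hbc.ne' (eq_of_mem_branch_of_adj hT hab
    (mem_branch_of_adj (mem_branch_self hab.ne') hbc hac.ne') hac)

theorem eq_of_common_neighbors (hT : T.IsAcyclic) {a b p : V} (hva : T.Adj v a) (hvb : T.Adj v b)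
    (hpa : T.Adj a p) (hpb : T.Adj b p) (hpv : p ≠ v) : a = b :=
  (eq_of_mem_branch_of_adj hT hva (mem_branch_of_adj
    (mem_branch_of_adj (mem_branch_self hva.ne') hpa hpv) hpb.symm hvb.ne') hvb).symm

theorem mem_branch_decomp (hx : x ∈ branch T u v) :
    x = v ∨ ∃ w, T.Adj v w ∧ w ≠ u ∧ x ∈ branch T v w := by
  have key : branch T u v ⊆ {x | x = v ∨ ∃ w, T.Adj v w ∧ w ≠ u ∧ x ∈ branch T v w} := by
    refine branch_subset (Or.inl rfl) ?_
    rintro a (rfl | ⟨w, hw, hwu, ha⟩) b hab hbu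
    · exact Or.inr ⟨b, hab, hbu, mem_branch_self hab.ne'⟩
    · by_cases hbv : b = v
      · exact Or.inl hbv
      · exact Or.inr ⟨w, hw, hwu, mem_branch_of_adj ha hab hbv⟩
  exact key hx

theorem branch_subset_branch (hT : T.IsAcyclic) (huv : T.Adj u v) (hvw : T.Adj v w) (hwu : w ≠ u) :
    branch T v w ⊆ branch T u v := by
  have hu : u ∉ branch T v w := fun h => hwu (eq_of_mem_branch_of_adj hT hvw h huv.symm).symm
  have key : branch T v w ⊆ branch T v w ∩ branch T u v := by
    refine branch_subset ⟨mem_branch_self hvw.ne',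
      mem_branch_of_adj (mem_branch_self huv.ne') hvw hwu⟩ ?_
    rintro a ⟨h1, h2⟩ b hab hbv
    have h3 := mem_branch_of_adj h1 hab hbv
    exact ⟨h3, mem_branch_of_adj h2 hab (by rintro rfl; exact hu h3)⟩
  exact key.trans Set.inter_subset_right

/-- Strictness allows searches in the tree to descend by induction on the size of a branch. -/
theorem branch_ssubset_branch (hT : T.IsAcyclic) (huv : T.Adj u v) (hvw : T.Adj v w) (hwu : w ≠ u) :
    branch T v w ⊂ branch T u v :=
  ⟨branch_subset_branch hT huv hvw hwu, fun h =>
    ne_of_mem_branch (h (mem_branch_self huv.ne')) rfl⟩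

theorem eq_of_adj_of_notMem_branch (hT : T.IsAcyclic) (huv : T.Adj u v) (hx : x ∈ branch T u v)
    (hy : y ∉ branch T u v) (hxy : T.Adj x y) : x = v ∧ y = u := by
  have hyu : y = u := by
    by_contra h
    exact hy (mem_branch_of_adj hx hxy h)
  subst hyu
  exact ⟨eq_of_mem_branch_of_adj hT huv hx hxy.symm, rfl⟩

theorem mem_branch_of_adj_of_ne (hT : T.IsAcyclic) (huv : T.Adj u v) (hx : x ∈ branch T u v)
    (hxv : x ≠ v) (hxy : T.Adj x y) : y ∈ branch T u v := by
  by_contra hy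
  exact hxv (eq_of_adj_of_notMem_branch hT huv hx hy hxy).1

end Branch

/-! ### Rigidity of minimum functions at a hub -/

section Hub

variable {V : Type u} {T : SimpleGraph V} {X : Set V} {u v : V}

/-- In the component of `T - u` that contains the neighbor `v` of `u`, all vertices of `X` belong
to the closed neighborhood of `v`, and some neighbor of `v` there belongs to `X`. -/
structure IsHub (T : SimpleGraph V) (X : Set V) (u v : V) : Prop where
  acyclic : T.IsAcyclic
  adj : T.Adj u v
  near : ∀ x ∈ branch T u v, x ∈ X → x = v ∨ T.Adj v x
  exists_demand : ∃ w, T.Adj v w ∧ w ≠ u ∧ w ∈ X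

theorem IsHub.mem_self (hH : IsHub T X u v) : v ∈ branch T u v := mem_branch_self hH.adj.ne'

theorem IsHub.mem_of_adj (hH : IsHub T X u v) {w : V} (hw : T.Adj v w) (hwu : w ≠ u) :
    w ∈ branch T u v := mem_branch_of_adj hH.mem_self hw hwu

theorem IsHub.covered {g : V → ℕ} (hH : IsHub T X u v) (hR : IsRDF T X g) {w : V}
    (hw : T.Adj v w) (hwu : w ≠ u) (hwX : w ∈ X) :
    1 ≤ g w ∨ ∃ p ∈ branch T u v, T.Adj w p ∧ g p = 2 := by
  rcases hR.dominates hwX with h | ⟨p, hp, h⟩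
  · exact Or.inl h
  · exact Or.inr ⟨p, mem_branch_of_adj_of_ne hH.acyclic hH.adj (hH.mem_of_adj hw hwu) hw.ne' hp,
      hp, h⟩

open scoped Classical in
/-- All weight on the branch at the hub `v` is replaced by the value `2` at `v`. -/
noncomputable def collapse (T : SimpleGraph V) (u v : V) (g : V → ℕ) : V → ℕ :=
  fun x => if x = v then 2 else if x ∈ branch T u v then 0 else g x

/-- By `near`, a 2 at `v` serves all demands of the branch, and no other vertex of the branch has a
neighbor outside. -/
theorem IsHub.isRDF_collapse {g : V → ℕ} (hH : IsHub T X u v) (hR : IsRDF T X g) :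
    IsRDF T X (collapse T u v g) := by
  refine ⟨fun x => ?_, fun x hx hx0 => ?_⟩
  · unfold collapse
    split_ifs
    · simp
    · simp
    · exact hR.1 x
  have hv : collapse T u v g v = 2 := by simp [collapse]
  by_cases hxS : x ∈ branch T u v
  · rcases hH.near x hxS hx with rfl | h
    · omega
    · exact ⟨v, h.symm, hv⟩
  · have hxv : x ≠ v := by rintro rfl; exact hxS hH.mem_self
    simp only [collapse, hxv, hxS, if_false] at hx0
    obtain ⟨y, hy, hy2⟩ := hR.2 x hx hx0
    by_cases hyS : y ∈ branch T u v
    · obtain ⟨rfl, rfl⟩ := eq_of_adj_of_notMem_branch hH.acyclic hH.adj hyS hxS hy.symm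
      exact ⟨y, hy, hv⟩
    · have hyv : y ≠ v := by rintro rfl; exact hyS hH.mem_self
      exact ⟨y, hy, by simp [collapse, hyv, hyS, hy2]⟩

variable [Fintype V] {g : V → ℕ}

/-- In a strong graph, some vertex of the branch at a hub is either the hub and positive, or has
value `2`. -/
theorem IsHub.not_low (hH : IsHub T X u v) (hS : Strong T X) (hg : IsMinWRDF T X g)
    (hv : g v = 0) (hle : ∀ p ∈ branch T u v, g p ≤ 1) : False := by
  classical
  have hR := hS g hg
  have pos : ∀ w, T.Adj v w → w ≠ u → w ∈ X → g w = 1 := fun w hw hwu hwX => by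
    have h1 := hle w (hH.mem_of_adj hw hwu)
    rcases hH.covered hR hw hwu hwX with h | ⟨p, hp, -, h⟩
    · omega
    · have := hle p hp
      omega
  have nu : ∀ x ∈ branch T u v, x ≠ u := fun x hx => ne_of_mem_branch hx
  obtain ⟨w, hvw, hwu, hwX⟩ := hH.exists_demand
  have hwS := hH.mem_of_adj hvw hwu
  have hgw := pos w hvw hwu hwX
  -- Without a 2 on the branch, each demanded neighbor of `v` there has value 1. Moving the unit of
  -- `w` to `v` keeps the weight; `v` can return it to defend `w`, but `w` sees no 2.
  set h : V → ℕ := Function.update (Function.update g w 0) v 1 with hdef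
  have hhv : h v = 1 := by simp [hdef]
  have hhw : h w = 0 := by rw [hdef, Function.update_of_ne hvw.ne']; simp
  have ho : ∀ a, a ≠ v → a ≠ w → h a = g a := fun a h1 h2 => by
    rw [hdef, Function.update_of_ne h1, Function.update_of_ne h2]
  have hw1 := weight_update g w 0
  have hw2 : weight h + _ = _ := weight_update (Function.update g w 0) v 1
  rw [Function.update_of_ne hvw.ne, hv] at hw2
  have out : ∀ a, a ∉ branch T u v → h a = g a := fun a ha =>
    ho a (by rintro rfl; exact ha hH.mem_self) (by rintro rfl; exact ha hwS)
  have two : ∀ q ∈ X, g q = 0 → q ∉ branch T u v →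
      ∃ y, T.Adj q y ∧ h y = 2 ∧ y ≠ v := fun q hq hq0 hqS => by
    obtain ⟨y, hy, hy2⟩ := hR.2 q hq hq0
    have hyS : y ∉ branch T u v := fun h => by have := hle y h; omega
    exact ⟨y, hy, by rw [out y hyS, hy2], by rintro rfl; exact hyS hH.mem_self⟩
  have hdom : ∀ q ∈ X, 1 ≤ h q ∨ ∃ y, T.Adj q y ∧ 1 ≤ h y := by
    intro q hq
    by_cases hqS : q ∈ branch T u v
    · rcases hH.near q hqS hq with rfl | h
      · exact Or.inl hhv.ge
      · exact Or.inr ⟨v, h.symm, hhv.ge⟩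
    · by_cases hq0 : g q = 0
      · obtain ⟨y, hy, hy2, -⟩ := two q hq hq0 hqS
        exact Or.inr ⟨y, hy, by omega⟩
      · exact Or.inl (by rw [out q hqS]; omega)
  have hW : IsWRDF T X h := by
    refine ⟨fun x => mem_values_iff.2 ?_, fun x hx hx0 => ?_⟩
    · rcases eq_or_ne x v with rfl | h1
      · omega
      rcases eq_or_ne x w with rfl | h2
      · omega
      rw [ho x h1 h2]; exact hg.1.le_two x
    by_cases hxS : x ∈ branch T u v
    · rcases hH.near x hxS hx with rfl | hvx
      · omega
      obtain rfl : x = w := by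
        by_contra hxw
        rw [ho x hvx.ne' hxw, pos x hvx (nu x hxS) hx] at hx0
        omega
      refine isDefended_iff.2 ⟨v, hvx.symm, hhv.ge, fun q hq => ?_⟩
      by_cases hqS : q ∈ branch T u v
      · rcases hH.near q hqS hq with rfl | hvq
        · exact ⟨x, Or.inr hvx, Or.inl rfl⟩
        · by_cases hqx : q = x
          · exact ⟨q, Or.inl rfl, Or.inl hqx⟩
          · refine ⟨q, Or.inl rfl, Or.inr ⟨?_, fun h => absurd h hvq.ne'⟩⟩
            rw [ho q hvq.ne' hqx, pos q hvq (nu q hqS) hq]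
      · by_cases hq0 : g q = 0
        · obtain ⟨y, hy, hy2, hyv⟩ := two q hq hq0 hqS
          exact ⟨y, Or.inr hy, Or.inr ⟨by omega, fun h => absurd h hyv⟩⟩
        · refine ⟨q, Or.inl rfl, Or.inr ⟨by rw [out q hqS]; omega, ?_⟩⟩
          rintro rfl
          exact absurd hH.mem_self hqS
    · rw [out x hxS] at hx0
      obtain ⟨y, hy, hy2, -⟩ := two x hx hx0 hxS
      exact isDefended_of_adj_two hy hy2 hdom
  obtain ⟨y, hy, hy2⟩ := (hS h (hg.of_weight_le hW (by omega))).2 w hwX hhw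
  have hyS := mem_branch_of_adj_of_ne hH.acyclic hH.adj hwS hvw.ne' hy
  have h1 : y ≠ v := by rintro rfl; omega
  rw [ho y h1 hy.ne'] at hy2
  have := hle y hyS
  omega

open scoped Classical in
theorem IsHub.weight_collapse (hH : IsHub T X u v) (g : V → ℕ) :
    weight (collapse T u v g) + ∑ x with x ∈ branch T u v, g x = weight g + 2 := by
  unfold weight
  rw [← Finset.sum_filter_add_sum_filter_not Finset.univ (fun x => x ∈ branch T u v) g,
    ← Finset.sum_filter_add_sum_filter_not Finset.univ (fun x => x ∈ branch T u v)
      (collapse T u v g)]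
  have h1 : ∑ x with x ∈ branch T u v, collapse T u v g x = 2 := by
    rw [Finset.sum_eq_single_of_mem v (by simpa using hH.mem_self)]
    · simp [collapse]
    · intro b hb hbv
      simp only [Finset.mem_filter, Finset.mem_univ, true_and] at hb
      simp [collapse, hbv, hb]
  have h2 : ∑ x with x ∉ branch T u v, collapse T u v g x = ∑ x with x ∉ branch T u v, g x := by
    refine Finset.sum_congr rfl fun x hx => ?_
    simp only [Finset.mem_filter, Finset.mem_univ, true_and] at hx
    have : x ≠ v := by rintro rfl; exact hx hH.mem_self
    simp [collapse, hx, this]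
  omega

/-- In a strong forest, minimum functions have value `2` at a hub and vanish on the rest of its
branch. -/
theorem IsHub.apply_eq (hH : IsHub T X u v) (hS : Strong T X) (hg : IsMinWRDF T X g) :
    g v = 2 ∧ ∀ x ∈ branch T u v, x ≠ v → g x = 0 := by
  classical
  have hR := hS g hg
  have hR' := hH.isRDF_collapse hR
  have hw := hH.weight_collapse g
  have hw' := hg.weight_le hR'.isWRDF
  -- Collapsing puts weight 2 on the branch, so a minimum function spends at most 2 there.
  have sum_le : ∀ s : Finset V, (∀ x ∈ s, x ∈ branch T u v) → ∑ x ∈ s, g x ≤ 2 := fun s hs => by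
    have h1 : ∑ x ∈ s, g x ≤ ∑ x with x ∈ branch T u v, g x :=
      Finset.sum_le_sum_of_subset fun x hx => by simpa using hs x hx
    have h2 : ∑ x with x ∈ branch T u v, g x ≤ 2 := by
      omega
    exact h1.trans h2
  have pair : ∀ a ∈ branch T u v, ∀ b ∈ branch T u v, a ≠ b → g a + g b ≤ 2 := by
    intro a ha b hb hab
    have := sum_le {a, b} (by
      intro x hx
      simp only [Finset.mem_insert, Finset.mem_singleton] at hx
      rcases hx with rfl | rfl <;> assumption)
    rwa [Finset.sum_pair hab] at this
  have triple : ∀ a ∈ branch T u v, ∀ b ∈ branch T u v, ∀ c ∈ branch T u v,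
      a ≠ b → a ≠ c → b ≠ c → g a + (g b + g c) ≤ 2 := by
    intro a ha b hb c hc hab hac hbc
    have := sum_le {a, b, c} (by
      intro x hx
      simp only [Finset.mem_insert, Finset.mem_singleton] at hx
      rcases hx with rfl | rfl | rfl <;> assumption)
    rwa [Finset.sum_insert (by simp [hab, hac]), Finset.sum_pair hbc] at this
  have hvS := hH.mem_self
  by_cases hv2 : g v = 2
  · refine ⟨hv2, fun x hx hxv => ?_⟩
    have := pair v hvS x hx hxv.symm
    omega
  exfalso
  have hv1 : g v ≤ 1 := by have := hg.1.le_two v; omega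
  obtain ⟨w, hvw, hwu, hwX⟩ := hH.exists_demand
  have hwS := hH.mem_of_adj hvw hwu
  by_cases hs : ∑ x with x ∈ branch T u v, g x = 2
  -- If exactly 2 is spent, the collapsed function is also minimum, and its private neighbors at `v`
  -- provide two demanded vertices `a`, `b` of the branch.
  · have hmin := hg.of_weight_le hR'.isWRDF (by omega)
    have hcv : collapse T u v g v = 2 := by simp [collapse]
    obtain ⟨a, ha, hau, -⟩ := hS.exists_isPrivate hmin hcv u u
    obtain ⟨b, hb, hbu, hba⟩ := hS.exists_isPrivate hmin hcv u a
    have haS := hH.mem_of_adj ha.2.1.symm hau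
    have hbS := hH.mem_of_adj hb.2.1.symm hbu
    have hav := ha.2.1.ne
    have hbv := hb.2.1.ne
    -- If `a` had value 0, a 2 at some `p ≠ v` next to `a` would use up the budget; then `p` would
    -- be `b` or serve `b` as well, closing a cycle.
    have hcov : ∀ a b, T.Adj v a → T.Adj v b → a ≠ u → b ≠ u → a ∈ X → b ∈ X → b ≠ a →
        1 ≤ g a := by
      intro a b hva hvb hau hbu haX hbX hba
      have haS := hH.mem_of_adj hva hau
      have hbS := hH.mem_of_adj hvb hbu
      rcases hH.covered hR hva hau haX with h | ⟨p, hp, hap, hp2⟩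
      · exact h
      exfalso
      have hpv : p ≠ v := by rintro rfl; omega
      have hpb : p ≠ b := by
        rintro rfl
        exact not_adj_of_adj_of_adj hH.acyclic v a p hva hvb hap
      rcases hH.covered hR hvb hbu hbX with h | ⟨q, hq, hbq, hq2⟩
      · have := pair p hp b hbS hpb
        omega
      · obtain rfl : q = p := by
          by_contra hqp
          have := pair q hq p hp hqp
          omega
        exact hba (eq_of_common_neighbors hH.acyclic hvb hva hbq hap hpv)
    have ha1 := hcov a b ha.2.1.symm hb.2.1.symm hau hbu ha.1 hb.1 hba
    have hb1 := hcov b a hb.2.1.symm ha.2.1.symm hbu hau hb.1 ha.1 hba.symm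
    have h3 := triple v hvS a haS b hbS hav.symm hbv.symm hba.symm
    refine hH.not_low hS hg (by omega) fun p hp => ?_
    by_contra hp1
    rcases eq_or_ne p a with rfl | hpa
    · omega
    · have := pair p hp a haS hpa
      omega
  -- With budget at most 1 there is no 2 on the branch, and the demanded neighbor `w` takes the only
  -- unit, leaving 0 at `v`.
  · have hle : ∀ s : Finset V, (∀ x ∈ s, x ∈ branch T u v) → ∑ x ∈ s, g x ≤ 1 := fun s hs => by
      have h1 : ∑ x ∈ s, g x ≤ ∑ x with x ∈ branch T u v, g x :=
        Finset.sum_le_sum_of_subset fun x hx => by simpa using hs x hx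
      omega
    have hle1 : ∀ p ∈ branch T u v, g p ≤ 1 := fun p hp => by
      simpa using hle {p} (by simpa using hp)
    refine hH.not_low hS hg ?_ hle1
    by_contra hv0
    have h1 := hle {v, w} (by
      intro x hx
      simp only [Finset.mem_insert, Finset.mem_singleton] at hx
      rcases hx with rfl | rfl <;> assumption)
    rw [Finset.sum_pair hvw.ne] at h1
    rcases hH.covered hR hvw hwu hwX with h | ⟨p, hp, -, h⟩
    · omega
    · have := hle1 p hp
      omega

theorem IsHub.mem_coverable_of_adj (hH : IsHub T X u v) (hS : Strong T X) {x : V}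
    (hx : T.Adj v x) : x ∈ coverable T X := by
  obtain ⟨g, hg⟩ := exists_isMinWRDF T X
  exact mem_coverable_of_adj_two hg hx.symm (hH.apply_eq hS hg).1

theorem IsHub.mem_coverable (hH : IsHub T X u v) (hS : Strong T X) : v ∈ coverable T X := by
  obtain ⟨g, hg⟩ := exists_isMinWRDF T X
  exact ⟨g, hg, Or.inl (by rw [(hH.apply_eq hS hg).1]; omega)⟩

theorem IsHub.adj_of_mem_coverable (hH : IsHub T X u v) (hS : Strong T X) {x : V}
    (hx : x ∈ branch T u v) (hxv : x ≠ v) (hc : x ∈ coverable T X) : T.Adj v x := by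
  obtain ⟨g, hg, hc⟩ := hc
  obtain ⟨-, h0⟩ := hH.apply_eq hS hg
  rcases hc with hc | ⟨-, hc⟩
  · rw [h0 x hx hxv] at hc; omega
  · obtain ⟨y, hy, hy1, -⟩ := isDefended_iff.1 hc
    have hyS := mem_branch_of_adj_of_ne hH.acyclic hH.adj hx hxv hy
    by_contra hvx
    have hyv : y ≠ v := by rintro rfl; exact hvx hy.symm
    rw [h0 y hyS hyv] at hy1
    omega

/-- A hub has at least three demanding neighbors. -/
theorem IsHub.exists_demands (hH : IsHub T X u v) (hS : Strong T X) :
    ∃ a b, (T.Adj v a ∧ a ≠ u ∧ a ∈ X) ∧ (T.Adj v b ∧ b ≠ u ∧ b ∈ X) ∧ a ≠ b ∧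
      (u ∈ X ∨ ∃ c, (T.Adj v c ∧ c ≠ u ∧ c ∈ X) ∧ a ≠ c ∧ b ≠ c) := by
  obtain ⟨g, hg⟩ := exists_isMinWRDF T X
  have hv := (hH.apply_eq hS hg).1
  obtain ⟨a, ha, hau, -⟩ := hS.exists_isPrivate hg hv u u
  obtain ⟨b, hb, hbu, hba⟩ := hS.exists_isPrivate hg hv u a
  obtain ⟨c, hc, hca, hcb⟩ := hS.exists_isPrivate hg hv a b
  refine ⟨a, b, ⟨ha.2.1.symm, hau, ha.1⟩, ⟨hb.2.1.symm, hbu, hb.1⟩, hba.symm, ?_⟩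
  by_cases hcu : c = u
  · exact Or.inl (hcu ▸ hc.1)
  · exact Or.inr ⟨c, ⟨hc.2.1.symm, hcu, hc.1⟩, hca.symm, hcb.symm⟩

end Hub

/-! ### Hubs and configurations -/

section Configuration

/-- Two disjoint finite sets can be enumerated one after the other. -/
theorem exists_enumeration {V : Type u} (L R : Finset V) (hd : ∀ x ∈ L, x ∉ R) :
    ∃ w : Fin (L.card + R.card) → V, Function.Injective w ∧ (∀ x, x ∈ Set.range w ↔ x ∈ L ∨ x ∈ R) ∧
      (∀ i : Fin _, (i : ℕ) < L.card → w i ∈ L) ∧ ∀ i : Fin _, L.card ≤ (i : ℕ) → w i ∈ R := by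
  let w : Fin (L.card + R.card) → V :=
    Fin.addCases (fun i => (L.equivFin.symm i : V)) (fun i => (R.equivFin.symm i : V))
  have hl : ∀ i, w (Fin.castAdd _ i) = L.equivFin.symm i := fun i => by simp [w]
  have hr : ∀ i, w (Fin.natAdd _ i) = R.equivFin.symm i := fun i => by simp [w]
  refine ⟨w, ?_, ?_, ?_, ?_⟩
  · intro i j
    refine Fin.addCases (fun i => ?_) (fun i => ?_) i <;>
      refine Fin.addCases (fun j => ?_) (fun j => ?_) j <;> intro h
    · rw [hl, hl] at h
      rw [L.equivFin.symm.injective (Subtype.ext h)]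
    · rw [hl, hr] at h
      exact absurd (h ▸ (R.equivFin.symm j).2) (hd _ (L.equivFin.symm i).2)
    · rw [hl, hr] at h
      exact absurd (h ▸ (R.equivFin.symm i).2) (hd _ (L.equivFin.symm j).2)
    · rw [hr, hr] at h
      rw [R.equivFin.symm.injective (Subtype.ext h)]
  · intro x
    constructor
    · rintro ⟨i, rfl⟩
      refine Fin.addCases (fun i => ?_) (fun i => ?_) i
      · rw [hl]; exact Or.inl (L.equivFin.symm i).2
      · rw [hr]; exact Or.inr (R.equivFin.symm i).2
    · rintro (h | h)
      · exact ⟨Fin.castAdd _ (L.equivFin ⟨x, h⟩), by rw [hl]; simp⟩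
      · exact ⟨Fin.natAdd _ (R.equivFin ⟨x, h⟩), by rw [hr]; simp⟩
  · intro i
    refine Fin.addCases (fun i => ?_) (fun i => ?_) i <;> intro h
    · rw [hl]; exact (L.equivFin.symm i).2
    · simp at h
  · intro i
    refine Fin.addCases (fun i => ?_) (fun i => ?_) i <;> intro h
    · have := i.2
      simp at h
      omega
    · rw [hr]; exact (R.equivFin.symm i).2

variable {A : Triple.{u}} {u v : A.V}

/-- The neighbors of `v` other than `u` are listed with the demanded ones first, so `ℓ` counts
these, and `IsHub.exists_demands` bounds it below. Rigidity leaves `w i` as the only coverable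
vertex of its branch. -/
theorem IsHub.exists_isConfiguration (hH : IsHub A.T A.X u v) (hS : Strong A.T A.X)
    (hY : A.Y = coverable A.T A.X) :
    ∃ (k : ℕ) (w : Fin k → A.V), A.IsConfiguration u v k w := by
  classical
  obtain ⟨L, memL⟩ : ∃ L : Finset A.V, ∀ x, x ∈ L ↔ A.T.Adj v x ∧ x ≠ u ∧ x ∈ A.X :=
    ⟨Finset.univ.filter fun x => A.T.Adj v x ∧ x ≠ u ∧ x ∈ A.X, fun x => by simp⟩
  obtain ⟨R, memR⟩ : ∃ R : Finset A.V, ∀ x, x ∈ R ↔ A.T.Adj v x ∧ x ≠ u ∧ x ∉ A.X :=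
    ⟨Finset.univ.filter fun x => A.T.Adj v x ∧ x ≠ u ∧ x ∉ A.X, fun x => by simp⟩
  obtain ⟨w, hinj, hrange, hwL, hwR⟩ := exists_enumeration L R
    (fun x hx => by rw [memL] at hx; rw [memR]; tauto)
  have hw : ∀ i, A.T.Adj v (w i) ∧ w i ≠ u := fun i => by
    rcases (hrange _).1 ⟨i, rfl⟩ with h | h
    · exact ⟨((memL _).1 h).1, ((memL _).1 h).2.1⟩
    · exact ⟨((memR _).1 h).1, ((memR _).1 h).2.1⟩
  have hsub : ∀ i, branch A.T v (w i) ⊆ branch A.T u v := fun i =>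
    branch_subset_branch hH.acyclic hH.adj (hw i).1 (hw i).2
  have hbX : ∀ i, ∀ x ∈ branch A.T v (w i), x ∈ A.X → x = w i := fun i x hx hxX => by
    rcases hH.near x (hsub i hx) hxX with rfl | h
    · exact absurd rfl (ne_of_mem_branch hx)
    · exact eq_of_mem_branch_of_adj hH.acyclic (hw i).1 hx h
  have hself : ∀ i, w i ∈ branch A.T v (w i) := fun i => mem_branch_self (hw i).1.ne'
  have hbY : ∀ i, branch A.T v (w i) ∩ A.Y = {w i} := fun i => by
    rw [hY]
    ext x
    constructor
    · rintro ⟨hx, hxY⟩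
      exact eq_of_mem_branch_of_adj hH.acyclic (hw i).1 hx
        (hH.adj_of_mem_coverable hS (hsub i hx) (ne_of_mem_branch hx) hxY)
    · rintro rfl
      exact ⟨hself i, hH.mem_coverable_of_adj hS (hw i).1⟩
  have huY : u ∈ A.Y := hY ▸ hH.mem_coverable_of_adj hS hH.adj.symm
  have hvY : v ∈ A.Y := hY ▸ hH.mem_coverable hS
  obtain ⟨a, b, ha, hb, hab, hc⟩ := hH.exists_demands hS
  have h2 : 2 ≤ L.card := by
    rw [← Finset.card_pair hab]
    refine Finset.card_le_card fun x hx => ?_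
    simp only [Finset.mem_insert, Finset.mem_singleton] at hx
    rcases hx with rfl | rfl
    exacts [(memL _).2 ha, (memL _).2 hb]
  have h3 : u ∈ A.X ∨ 3 ≤ L.card := by
    refine hc.imp_right ?_
    rintro ⟨c, hc, hac, hbc⟩
    rw [← Finset.card_eq_three.2 ⟨a, b, c, hab, hac, hbc, rfl⟩]
    refine Finset.card_le_card fun x hx => ?_
    simp only [Finset.mem_insert, Finset.mem_singleton] at hx
    rcases hx with rfl | rfl | rfl
    exacts [(memL _).2 ha, (memL _).2 hb, (memL _).2 hc]
  refine ⟨_, w, hinj, ?_, ?_, L.card, by omega, by omega, ?_, ?_, ?_⟩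
  · rintro ⟨i, hi⟩
    exact (hw i).2 hi
  · ext x
    rw [SimpleGraph.mem_neighborSet, Set.mem_union, hrange, memL, memR, Set.mem_singleton_iff]
    constructor
    · intro h
      tauto
    · rintro (rfl | h | h)
      exacts [hH.adj.symm, h.1, h.1]
  · intro i hi
    ext x
    constructor
    · rintro ⟨hx, hxX⟩
      exact hbX i x hx hxX
    · rintro rfl
      exact ⟨hself i, ((memL _).1 (hwL i hi)).2.2⟩
  · intro i hi
    ext x
    refine iff_of_false ?_ (Set.notMem_empty x)
    rintro ⟨hx, hxX⟩
    obtain rfl := hbX i x hx hxX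
    exact ((memR _).1 (hwR i hi)).2.2 hxX
  · by_cases h : 3 ≤ L.card
    · exact Or.inr ⟨h, huY, hvY, hbY⟩
    · exact Or.inl ⟨by omega, h3.resolve_right h, huY, hvY, hbY⟩

theorem Triple.IsConfiguration.adj_iff {k : ℕ} {w : Fin k → A.V} (hC : A.IsConfiguration u v k w)
    {x : A.V} : A.T.Adj v x ↔ x = u ∨ ∃ i, w i = x := by
  rw [← SimpleGraph.mem_neighborSet, hC.2.2.1]
  simp

/-- Apart from `v`, the branch consists of the branches of the `w i`, where only `w i` can be
demanded; `ℓ ≥ 1` supplies a demand. -/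
theorem Triple.IsConfiguration.isHub {k : ℕ} {w : Fin k → A.V} (hC : A.IsConfiguration u v k w)
    (hT : A.T.IsAcyclic) : IsHub A.T A.X u v := by
  obtain ⟨ℓ, h1, hk, hlt, hge, -⟩ := hC.2.2.2
  refine ⟨hT, (hC.adj_iff.2 (Or.inl rfl)).symm, fun x hx hxX => ?_, ?_⟩
  · rcases mem_branch_decomp hx with h | ⟨y, hy, hyu, hxy⟩
    · exact Or.inl h
    · obtain ⟨i, rfl⟩ := (hC.adj_iff.1 hy).resolve_left hyu
      rcases lt_or_ge (i : ℕ) ℓ with hi | hi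
      · have : x ∈ branch A.T v (w i) ∩ A.X := ⟨hxy, hxX⟩
        rw [hlt i hi] at this
        rw [Set.mem_singleton_iff.1 this]
        exact Or.inr hy
      · have : x ∈ branch A.T v (w i) ∩ A.X := ⟨hxy, hxX⟩
        rw [hge i hi] at this
        exact absurd this (Set.notMem_empty x)
  · have h0 : 0 < k := by omega
    have := hlt ⟨0, h0⟩ h1
    refine ⟨w ⟨0, h0⟩, hC.adj_iff.2 (Or.inr ⟨_, rfl⟩), ?_, ?_⟩
    · intro h
      exact hC.2.1 ⟨_, h⟩
    · have : w ⟨0, h0⟩ ∈ branch A.T v (w ⟨0, h0⟩) ∩ A.X := by rw [this]; rfl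
      exact this.2

end Configuration

/-! ### Edge-set descriptions of the extensions -/

section Arises

variable {V W : Type u} {G : SimpleGraph V} {H : SimpleGraph W} {φ : V ↪ W} {u : V} {v : W}
  {N L : Set W} {E : Set (Sym2 W)}

theorem ArisesByAdding.adj_iff (h : ArisesByAdding G H φ N E) {x y : W} :
    H.Adj x y ↔ (∃ a b, G.Adj a b ∧ φ a = x ∧ φ b = y) ∨ s(x, y) ∈ E := by
  rw [← SimpleGraph.mem_edgeSet, h.2, Set.mem_union]
  refine or_congr_left ⟨?_, ?_⟩
  · rintro ⟨e, he, hxy⟩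
    induction e with
    | h a b =>
      rw [SimpleGraph.mem_edgeSet] at he
      rw [Sym2.map_mk, Sym2.eq_iff] at hxy
      rcases hxy with ⟨h1, h2⟩ | ⟨h1, h2⟩
      · exact ⟨a, b, he, h1, h2⟩
      · exact ⟨b, a, he.symm, h2, h1⟩
  · rintro ⟨a, b, hab, rfl, rfl⟩
    exact ⟨s(a, b), hab, by simp⟩

/-- Given connectivity, counting edges rules out cycles, so an upper bound on the number of new
edges suffices. -/
theorem ArisesByAdding.isTree [Fintype V] [Fintype W] (h : ArisesByAdding G H φ N E)
    (hG : G.IsTree) (hE : E.ncard ≤ N.ncard) (hN : ∀ x ∈ N, ∃ a, H.Reachable (φ a) x) :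
    H.IsTree := by
  classical
  have hφ : ∀ a b, H.Reachable (φ a) (φ b) := fun a b => by
    let f : G →g H := ⟨φ, fun {a b} hab => h.adj_iff.2 (Or.inl ⟨a, b, hab, rfl, rfl⟩)⟩
    exact (hG.connected.preconnected a b).map f
  have hr : ∀ x, ∃ a, H.Reachable (φ a) x := fun x => by
    by_cases hx : x ∈ Set.range φ
    · obtain ⟨a, rfl⟩ := hx
      exact ⟨a, SimpleGraph.Reachable.refl _⟩
    · exact hN x (h.1 ▸ hx)
  have hconn : H.Connected := by
    have : Nonempty W := hG.connected.nonempty.map φ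
    refine ⟨fun x y => ?_⟩
    obtain ⟨a, ha⟩ := hr x
    obtain ⟨b, hb⟩ := hr y
    exact ha.symm.trans ((hφ a b).trans hb)
  rw [SimpleGraph.isTree_iff_connected_and_card] at hG ⊢
  refine ⟨hconn, le_antisymm ?_ hconn.card_vert_le_card_edgeSet_add_one⟩
  have h1 : Nat.card H.edgeSet ≤ Nat.card G.edgeSet + E.ncard := by
    rw [Nat.card_coe_set_eq, h.2]
    refine (Set.ncard_union_le _ _).trans ?_
    rw [Nat.card_coe_set_eq]
    gcongr
    exact Set.ncard_image_le (Set.toFinite _)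
  have h2 : Nat.card W = Nat.card V + N.ncard := by
    rw [← h.1, ← Set.ncard_add_ncard_compl (Set.range φ), ← Set.image_univ,
      Set.ncard_image_of_injective _ φ.injective, Set.ncard_univ]
  omega

/-- The edges of a star with center `v` and endvertices `L`, attached to `x`. -/
def starEdges (x v : W) (L : Set W) : Set (Sym2 W) := insert s(x, v) ((fun w => s(v, w)) '' L)

theorem mem_starEdges {x v a b : W} : s(a, b) ∈ starEdges x v L ↔
    (a = x ∧ b = v) ∨ (a = v ∧ b = x) ∨ (a = v ∧ b ∈ L) ∨ (b = v ∧ a ∈ L) := by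
  simp only [starEdges, Set.mem_insert_iff, Sym2.eq_iff, Set.mem_image]
  constructor
  · rintro ((h | h) | ⟨w, hw, ⟨rfl, rfl⟩ | ⟨rfl, rfl⟩⟩) <;> tauto
  · rintro (h | h | ⟨rfl, h⟩ | ⟨rfl, h⟩)
    · exact Or.inl (Or.inl h)
    · exact Or.inl (Or.inr h)
    · exact Or.inr ⟨b, h, Or.inl ⟨rfl, rfl⟩⟩
    · exact Or.inr ⟨a, h, Or.inr ⟨rfl, rfl⟩⟩

theorem ArisesByAdding.starExt (hv : v ∉ L)
    (h : ArisesByAdding G H φ (insert v L) (starEdges (φ u) v L)) : StarExt G H φ u v := by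
  have hmem : ∀ x, x ∉ Set.range φ ↔ x = v ∨ x ∈ L := fun x => by
    rw [← Set.mem_compl_iff, h.1, Set.mem_insert_iff]
  have hvr : ∀ a, φ a ≠ v := fun a ha => (hmem v).2 (Or.inl rfl) ⟨a, ha⟩
  have hLr : ∀ a, φ a ∉ L := fun a ha => (hmem _).2 (Or.inr ha) ⟨a, rfl⟩
  refine ⟨⟨fun a b => ?_, fun a x hx => ?_, (hmem v).2 (Or.inl rfl)⟩, fun x hx hxv => ?_,
    fun x y hx hxv hy hyv => ?_⟩
  · rw [h.adj_iff, mem_starEdges]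
    constructor
    · rintro (⟨a', b', hab, ha, hb⟩ | ⟨-, h⟩ | ⟨h, -⟩ | ⟨h, -⟩ | ⟨h, -⟩)
      · rwa [← φ.injective ha, ← φ.injective hb]
      all_goals exact absurd h (hvr _)
    · exact fun hab => Or.inl ⟨a, b, hab, rfl, rfl⟩
  · rw [h.adj_iff, mem_starEdges]
    constructor
    · rintro (⟨a', b', hab, -, hb⟩ | ⟨h1, h2⟩ | ⟨h, -⟩ | ⟨h, -⟩ | ⟨-, h⟩)
      · exact absurd ⟨b', hb⟩ hx
      · exact ⟨φ.injective h1, h2⟩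
      · exact absurd h (hvr _)
      · exact absurd h (hvr _)
      · exact absurd h (hLr _)
    · rintro ⟨rfl, rfl⟩
      exact Or.inr (Or.inl ⟨rfl, rfl⟩)
  · rw [h.adj_iff, mem_starEdges]
    exact Or.inr (Or.inr (Or.inr (Or.inr ⟨rfl, ((hmem x).1 hx).resolve_left hxv⟩)))
  · rw [h.adj_iff, mem_starEdges]
    rintro (⟨a', b', hab, ha, hb⟩ | ⟨-, h⟩ | ⟨h, -⟩ | ⟨h, -⟩ | ⟨h, -⟩)
    · exact hx ⟨a', ha⟩
    · exact hyv h
    · exact hxv h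
    · exact hxv h
    · exact hyv h

theorem ArisesByAdding.isTree_of_star [Fintype V] [Fintype W] (hv : v ∉ L)
    (h : ArisesByAdding G H φ (insert v L) (starEdges (φ u) v L)) (hG : G.IsTree) : H.IsTree := by
  have P := h.starExt hv
  refine h.isTree hG ?_ fun x hx => ⟨u, ?_⟩
  · rw [Set.ncard_insert_of_notMem hv]
    refine (Set.ncard_insert_le _ _).trans ?_
    gcongr
    exact Set.ncard_image_le (Set.toFinite _)
  · by_cases hxv : x = v
    · subst hxv
      exact P.adj.reachable
    · exact P.adj.reachable.trans (P.adj_center x (by rw [← Set.mem_compl_iff, h.1]; exact hx)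
        hxv).symm.reachable

theorem StarExt.arisesByAdding (P : StarExt G H φ u v) (hL : (Set.range φ)ᶜ = insert v L)
    (hv : v ∉ L) : ArisesByAdding G H φ (insert v L) (starEdges (φ u) v L) := by
  refine ⟨hL, ?_⟩
  have hmem : ∀ x, x ∉ Set.range φ ↔ x = v ∨ x ∈ L := fun x => by
    rw [← Set.mem_compl_iff, hL, Set.mem_insert_iff]
  have hLm : ∀ x ∈ L, x ∉ Set.range φ ∧ x ≠ v := fun x hx =>
    ⟨(hmem x).2 (Or.inr hx), by rintro rfl; exact hv hx⟩
  ext e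
  induction e with
  | h x y =>
    rw [SimpleGraph.mem_edgeSet, Set.mem_union, mem_starEdges]
    constructor
    · intro hxy
      by_cases hx : x ∈ Set.range φ
      · obtain ⟨a, rfl⟩ := hx
        by_cases hy : y ∈ Set.range φ
        · obtain ⟨b, rfl⟩ := hy
          exact Or.inl ⟨s(a, b), (P.adj_iff _ _).1 hxy, by simp⟩
        · obtain ⟨rfl, rfl⟩ := (P.cross a y hy).1 hxy
          exact Or.inr (Or.inl ⟨rfl, rfl⟩)
      · by_cases hy : y ∈ Set.range φ
        · obtain ⟨b, rfl⟩ := hy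
          obtain ⟨rfl, rfl⟩ := (P.cross b x hx).1 hxy.symm
          exact Or.inr (Or.inr (Or.inl ⟨rfl, rfl⟩))
        · by_cases hxv : x = v
          · subst hxv
            exact Or.inr (Or.inr (Or.inr (Or.inl ⟨rfl, ((hmem y).1 hy).resolve_left hxy.ne'⟩)))
          · exact Or.inr (Or.inr (Or.inr (Or.inr ⟨P.eq_of_adj hx hxv hxy,
              ((hmem x).1 hx).resolve_left hxv⟩)))
    · rintro (⟨e, he, hxy⟩ | ⟨rfl, rfl⟩ | ⟨rfl, rfl⟩ | ⟨rfl, h⟩ | ⟨rfl, h⟩)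
      · induction e with
        | h a b =>
          rw [SimpleGraph.mem_edgeSet] at he
          rw [Sym2.map_mk, Sym2.eq_iff] at hxy
          rcases hxy with ⟨rfl, rfl⟩ | ⟨rfl, rfl⟩
          · exact (P.adj_iff _ _).2 he
          · exact ((P.adj_iff _ _).2 he).symm
      · exact P.adj
      · exact P.adj.symm
      · exact (P.adj_center y (hLm y h).1 (hLm y h).2).symm
      · exact P.adj_center x (hLm x h).1 (hLm x h).2

theorem LeafExt.starExt (P : LeafExt G H φ u v) : StarExt G H φ u v :=
  ⟨P.toPendantExt, fun x hx hxv => absurd (P.eq_of_notMem x hx) hxv,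
    fun x _ hx hxv _ _ => absurd (P.eq_of_notMem x hx) hxv⟩

theorem LeafExt.range_compl (P : LeafExt G H φ u v) : (Set.range φ)ᶜ = {v} := by
  ext x
  exact ⟨P.eq_of_notMem x, by rintro rfl; exact P.notMem⟩

theorem starEdges_empty (x v : W) : starEdges x v ∅ = {s(x, v)} := by simp [starEdges]

theorem starEdges_two (x v w₁ w₂ : W) :
    starEdges x v {w₁, w₂} = {s(x, v), s(v, w₁), s(v, w₂)} := by
  simp [starEdges, Set.image_insert_eq]

theorem starEdges_three (x v w₁ w₂ w₃ : W) :
    starEdges x v {w₁, w₂, w₃} = {s(x, v), s(v, w₁), s(v, w₂), s(v, w₃)} := by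
  simp [starEdges, Set.image_insert_eq]

theorem LeafExt.arisesByAdding (P : LeafExt G H φ u v) :
    ArisesByAdding G H φ {v} {s(φ u, v)} := by
  have := P.starExt.arisesByAdding (L := ∅) (by rw [P.range_compl]; simp) (Set.notMem_empty _)
  rwa [starEdges_empty, insert_empty_eq] at this

theorem ArisesByAdding.leafExt (h : ArisesByAdding G H φ {v} {s(φ u, v)}) :
    LeafExt G H φ u v := by
  have h' : ArisesByAdding G H φ (insert v ∅) (starEdges (φ u) v ∅) := by
    rwa [starEdges_empty, insert_empty_eq]
  refine ⟨(h'.starExt (Set.notMem_empty _)).toPendantExt, fun x hx => ?_⟩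
  rw [← Set.mem_compl_iff, h.1] at hx
  exact hx

theorem ArisesByAdding.isTree_of_leaf [Fintype V] [Fintype W]
    (h : ArisesByAdding G H φ {v} {s(φ u, v)}) (hG : G.IsTree) : H.IsTree := by
  have h' : ArisesByAdding G H φ (insert v ∅) (starEdges (φ u) v ∅) := by
    rwa [starEdges_empty, insert_empty_eq]
  exact h'.isTree_of_star (Set.notMem_empty _) hG

end Arises

/-! ### Empty demand set -/

section EmptyDemand

variable {V : Type u} [Fintype V] {G : SimpleGraph V}

theorem isMinWRDF_empty {g : V → ℕ} (hg : IsMinWRDF G ∅ g) (x : V) : g x = 0 := by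
  have h0 : IsWRDF G ∅ (fun _ : V => 0) := ⟨fun _ => by simp, fun _ h => absurd h (Set.notMem_empty _)⟩
  have h1 := hg.weight_le h0
  have h2 : g x ≤ weight g := Finset.single_le_sum (fun _ _ => Nat.zero_le _) (Finset.mem_univ x)
  have h3 : weight (fun _ : V => 0) = 0 := Finset.sum_const_zero
  omega

theorem coverable_empty : coverable G ∅ = ∅ := by
  ext x
  refine iff_of_false ?_ (Set.notMem_empty x)
  rintro ⟨g, hg, hc⟩
  have h0 := isMinWRDF_empty hg
  rcases hc with h | ⟨-, h⟩
  · have := h0 x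
    omega
  · obtain ⟨y, -, hy, -⟩ := isDefended_iff.1 h
    have := h0 y
    omega

theorem strong_empty : Strong G ∅ := fun _ hg => ⟨hg.1.1, fun _ h => absurd h (Set.notMem_empty _)⟩

end EmptyDemand

/-! ### The operations preserve `setS` -/

section Forward

theorem mem_setS_iff {A : Triple.{u}} :
    A ∈ setS ↔ A.T.IsTree ∧ Strong A.T A.X ∧ A.Y = coverable A.T A.X := Iff.rfl

variable {A B : Triple.{u}}

theorem apply_eq_zero_of_notMem_coverable {V : Type u} [Fintype V] {G : SimpleGraph V} {X : Set V}
    {u : V} (hu : u ∉ coverable G X) {g : V → ℕ} (hg : IsMinWRDF G X g) : g u = 0 := by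
  by_contra h
  exact hu ⟨g, hg, Or.inl (by omega)⟩

/-- Outside `Y` every minimum function vanishes, so the new endvertex is neither used nor covered.
-/
theorem Op1.mem_setS (hA : A ∈ setS) (h : Op1 A B) : B ∈ setS := by
  obtain ⟨hT, hS, hY⟩ := mem_setS_iff.1 hA
  obtain ⟨-, φ, u, v, hu, hadd, hBX, hBY⟩ := h
  rw [hY] at hu
  have P := hadd.leafExt
  have h0 : ∀ g, IsMinWRDF A.T A.X g → g u = 0 := fun g hg =>
    apply_eq_zero_of_notMem_coverable hu hg
  have hS' := P.strong hS (not_adj_of_adj_of_adj hT.isAcyclic) fun g hg => by rw [h0 g hg]; omega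
  refine mem_setS_iff.2 ⟨hadd.isTree_of_leaf hT, hBX ▸ hS', ?_⟩
  rw [hBX, hBY, hY, P.coverable_eq_of_never_two hS' fun g hg => by rw [h0 g hg]; omega]

/-- The hub forces value 0 at `w i`, which, though in `Y`, behaves like the vertex of Operation 1.
-/
theorem Op5.mem_setS (hA : A ∈ setS) (h : Op5 A B) : B ∈ setS := by
  obtain ⟨hT, hS, hY⟩ := mem_setS_iff.1 hA
  obtain ⟨-, φ, u, v, k, w, i, z, hC, hadd, hBX, hBY⟩ := h
  have P := hadd.leafExt
  have hH := hC.isHub hT.isAcyclic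
  have hvw : A.T.Adj v (w i) := hC.adj_iff.2 (Or.inr ⟨i, rfl⟩)
  have h0 : ∀ g, IsMinWRDF A.T A.X g → g (w i) = 0 := fun g hg =>
    (hH.apply_eq hS hg).2 _ (hH.mem_of_adj hvw fun h => hC.2.1 ⟨i, h⟩) hvw.ne'
  have hS' := P.strong hS (not_adj_of_adj_of_adj hT.isAcyclic) fun g hg => by rw [h0 g hg]; omega
  refine mem_setS_iff.2 ⟨hadd.isTree_of_leaf hT, hBX ▸ hS', ?_⟩
  rw [hBX, hBY, hY, P.coverable_eq_of_never_two hS' fun g hg => by rw [h0 g hg]; omega]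

/-- The hub forces value 2 at `v`, which covers the endvertex at no cost, so it may also be
demanded. -/
theorem Op4.mem_setS (hA : A ∈ setS) (h : Op4 A B) : B ∈ setS := by
  obtain ⟨hT, hS, hY⟩ := mem_setS_iff.1 hA
  obtain ⟨-, φ, u, v, k, w, z, hC, hadd, hBX, hBY⟩ := h
  have P := hadd.leafExt
  have hH := hC.isHub hT.isAcyclic
  have h2 : ∀ g, IsMinWRDF A.T A.X g → g v = 2 := fun g hg => (hH.apply_eq hS hg).1
  obtain ⟨g, hg⟩ := exists_isMinWRDF A.T A.X
  have hS' := P.strong hS (not_adj_of_adj_of_adj hT.isAcyclic) fun g hg => by rw [h2 g hg]; omega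
  have hc := P.coverable_eq_of_two hS' ⟨g, hg, h2 g hg⟩
  refine mem_setS_iff.2 ⟨hadd.isTree_of_leaf hT, ?_⟩
  rcases hBX with hBX | hBX
  · rw [hBX, hBY, hY, hc]
    exact ⟨hS', rfl⟩
  · have h2' : ∀ h, IsMinWRDF B.T (φ '' A.X) h → h (φ v) = 2 := fun h hh =>
      h2 _ (P.isMinWRDF_comp hh (P.apply_eq_zero_of_strong hS' hh))
    rw [hBX, hBY, hY, coverable_insert P.adj.symm h2', hc]
    exact ⟨hS'.insert P.adj.symm h2', rfl⟩

theorem Op3.mem_setS (hA : A ∈ setS) (h : Op3 A B) : B ∈ setS := by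
  obtain ⟨hT, hS, hY⟩ := mem_setS_iff.1 hA
  obtain ⟨-, φ, u, v, w₁, w₂, w₃, hu, hnd, hadd, hBX, hBY⟩ := h
  simp only [List.nodup_cons, List.mem_cons, List.not_mem_nil, or_false, not_or, List.nodup_nil,
    not_false_eq_true, and_true] at hnd
  obtain ⟨⟨hv1, hv2, hv3⟩, ⟨h12, h13⟩, h23⟩ := hnd
  rw [← starEdges_three] at hadd
  have hvL : v ∉ ({w₁, w₂, w₃} : Set B.V) := by simp [hv1, hv2, hv3]
  have P := hadd.starExt hvL
  have hr : (Set.range φ)ᶜ = {v, w₁, w₂, w₃} := hadd.1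
  have hn : ∀ x ∈ ({v, w₁, w₂, w₃} : Set B.V), x ∉ Set.range φ := fun x hx => by
    rw [← Set.mem_compl_iff, hr]; exact hx
  have hX1 : φ '' A.X ∪ {w₁, w₂, w₃} ⊆ B.X := by
    rcases hBX with h | h | h | h <;> rw [h] <;> intro x hx <;> simp at hx ⊢ <;> tauto
  have hX2 : B.X ⊆ φ '' A.X ∪ {φ u} ∪ (Set.range φ)ᶜ := by
    rw [hr]
    rcases hBX with h | h | h | h <;> rw [h] <;> intro x hx <;> simp at hx ⊢ <;> tauto
  have D : DemandExt φ u A.X B.X := ⟨Set.subset_union_left.trans hX1, hX2, hu⟩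
  have l1 : IsDemandingLeaf φ v B.X w₁ := ⟨hn _ (by simp), Ne.symm hv1, hX1 (by simp)⟩
  have l2 : IsDemandingLeaf φ v B.X w₂ := ⟨hn _ (by simp), Ne.symm hv2, hX1 (by simp)⟩
  have l3 : IsDemandingLeaf φ v B.X w₃ := ⟨hn _ (by simp), Ne.symm hv3, hX1 (by simp)⟩
  have hv : ∀ h, IsMinWRDF B.T B.X h → h v = 2 := fun h hh =>
    P.center_eq_two_of_three D l1 l2 l3 h12 h13 h23 hh
  refine mem_setS_iff.2 ⟨hadd.isTree_of_star hvL hT, P.strong D l1 l2 h12 hv hS, ?_⟩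
  rw [P.coverable_eq D l1 l2 h12 hv, hBY, hY, hr, Set.union_assoc]
  rfl

/-- The vertex `u`, now demanded but not coverable from the old tree, plays the role of a third
leaf. -/
theorem Op2.mem_setS (hA : A ∈ setS) (h : Op2 A B) : B ∈ setS := by
  obtain ⟨hT, hS, hY⟩ := mem_setS_iff.1 hA
  obtain ⟨-, φ, u, v, w₁, w₂, hu, hnd, hadd, hBX, hBY⟩ := h
  simp only [List.nodup_cons, List.mem_cons, List.not_mem_nil, or_false, not_or, List.nodup_nil,
    not_false_eq_true, and_true] at hnd
  obtain ⟨⟨hv1, hv2⟩, h12⟩ := hnd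
  rw [hY] at hu
  rw [← starEdges_two] at hadd
  have hvL : v ∉ ({w₁, w₂} : Set B.V) := by simp [hv1, hv2]
  have P := hadd.starExt hvL
  have hr : (Set.range φ)ᶜ = {v, w₁, w₂} := hadd.1
  have hn : ∀ x ∈ ({v, w₁, w₂} : Set B.V), x ∉ Set.range φ := fun x hx => by
    rw [← Set.mem_compl_iff, hr]; exact hx
  have hX1 : φ '' A.X ∪ {φ u, w₁, w₂} ⊆ B.X := by
    rcases hBX with h | h <;> rw [h] <;> intro x hx <;> simp at hx ⊢ <;> tauto
  have hX2 : B.X ⊆ φ '' A.X ∪ {φ u} ∪ (Set.range φ)ᶜ := by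
    rw [hr]
    rcases hBX with h | h <;> rw [h] <;> intro x hx <;> simp at hx ⊢ <;> tauto
  have D : DemandExt φ u A.X B.X :=
    ⟨Set.subset_union_left.trans hX1, hX2, fun h => hu (subset_coverable _ _ h)⟩
  have l1 : IsDemandingLeaf φ v B.X w₁ := ⟨hn _ (by simp), Ne.symm hv1, hX1 (by simp)⟩
  have l2 : IsDemandingLeaf φ v B.X w₂ := ⟨hn _ (by simp), Ne.symm hv2, hX1 (by simp)⟩
  have hv : ∀ h, IsMinWRDF B.T B.X h → h v = 2 := fun h hh =>
    P.center_eq_two_of_two D l1 l2 h12 (hX1 (by simp)) hu hh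
  refine mem_setS_iff.2 ⟨hadd.isTree_of_star hvL hT, P.strong D l1 l2 h12 hv hS, ?_⟩
  rw [P.coverable_eq D l1 l2 h12 hv, hBY, hY, hr, Set.union_assoc]
  rfl

theorem Generated.mem_setS (h : Generated A) : A ∈ setS := by
  induction h with
  | base_empty A hV hX hY =>
    have := Fintype.card_le_one_iff_subsingleton.1 hV.le
    have : Nonempty A.V := Fintype.card_pos_iff.1 (by omega)
    refine mem_setS_iff.2 ⟨SimpleGraph.IsTree.of_subsingleton, ?_, ?_⟩
    · rw [hX]; exact strong_empty
    · rw [hX, hY, coverable_empty]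
  | base_full A hV hX hY =>
    have := Fintype.card_le_one_iff_subsingleton.1 hV.le
    have : Nonempty A.V := Fintype.card_pos_iff.1 (by omega)
    refine mem_setS_iff.2 ⟨SimpleGraph.IsTree.of_subsingleton, fun g hg => ⟨hg.1.1, ?_⟩, ?_⟩
    · intro x hx hx0
      obtain ⟨y, hy, -⟩ := isDefended_iff.1 (hg.1.2 x hx hx0)
      exact absurd (Subsingleton.elim x y) hy.ne
    · rw [hY, eq_comm, ← Set.univ_subset_iff, ← hX]
      exact subset_coverable _ _
  | step A B _ hAB ih =>
    rcases hAB with h | h | h | h | h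
    exacts [h.mem_setS ih, h.mem_setS ih, h.mem_setS ih, h.mem_setS ih, h.mem_setS ih]

end Forward

/-! ### Removing endvertices and stars -/

section Restriction

variable {V W : Type u} {G : SimpleGraph V} {H : SimpleGraph W} {φ : V ↪ W} {u : V} {v : W}

theorem mem_of_connected {V : Type u} {T : SimpleGraph V} (hT : T.Connected) {C : Set V} {x : V}
    (hx : x ∈ C) (hC : ∀ a ∈ C, ∀ b, T.Adj a b → b ∈ C) (y : V) : y ∈ C := by
  obtain ⟨p⟩ := hT.preconnected x y
  induction p with
  | nil => exact hx
  | cons h p ih => exact ih (hC _ hx _ h)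

theorem PendantExt.isTree (P : PendantExt G H φ u v) (hH : H.IsTree) : G.IsTree := by
  have hf : ∀ {a b}, G.Adj a b → H.Adj (φ a) (φ b) := fun h => (P.adj_iff _ _).2 h
  refine ⟨?_, hH.isAcyclic.comap ⟨φ, hf⟩ φ.injective⟩
  have : Nonempty V := ⟨u⟩
  have key : ∀ a, G.Reachable u a := fun a => by
    -- The condition is vacuous off the image: a walk may enter the attached part, but it returns
    -- only through `u`.
    have := mem_of_connected hH.connected (C := {x | ∀ b, φ b = x → G.Reachable u b}) (x := φ u)
      (fun b hb => by rw [φ.injective hb]) ?_ (φ a)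
    · exact this a rfl
    · rintro x hx _ hxy b rfl
      by_cases hxr : x ∈ Set.range φ
      · obtain ⟨c, rfl⟩ := hxr
        exact (hx c rfl).trans ((P.adj_iff _ _).1 hxy).reachable
      · rw [((P.cross b x hxr).1 hxy.symm).1]
  exact ⟨fun a b => (key a).symm.trans (key b)⟩

theorem PendantExt.card_lt [Fintype V] [Fintype W] (P : PendantExt G H φ u v) :
    Fintype.card V < Fintype.card W :=
  Fintype.card_lt_of_injective_of_notMem φ φ.injective P.notMem

/-- An endvertex can be removed. -/
theorem exists_leafExt {W : Type u} [Fintype W] {H : SimpleGraph W} {z p : W} (hzp : H.Adj z p)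
    (hz : ∀ y, H.Adj z y → y = p) :
    ∃ (V : Type u) (_ : Fintype V) (G : SimpleGraph V) (φ : V ↪ W) (u : V),
      φ u = p ∧ LeafExt G H φ u z := by
  classical
  have hr : ∀ x, x ∉ Set.range (Function.Embedding.subtype fun x : W => x ≠ z) ↔ x = z := by simp
  refine ⟨{x // x ≠ z}, inferInstance, H.comap (Function.Embedding.subtype _),
    Function.Embedding.subtype _, ⟨p, hzp.ne'⟩, rfl, ⟨fun a b => Iff.rfl, fun a x hx => ?_,
      (hr z).2 rfl⟩, fun x hx => (hr x).1 hx⟩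
  obtain rfl := (hr x).1 hx
  constructor
  · exact fun h => ⟨Subtype.ext (hz _ h.symm), rfl⟩
  · rintro ⟨rfl, -⟩
    exact hzp.symm

/-- A star can be removed. -/
theorem exists_starExt {W : Type u} [Fintype W] {H : SimpleGraph W} {u v : W} (huv : H.Adj v u)
    (hL : ∀ w, H.Adj v w → w ≠ u → ∀ y, H.Adj w y → y = v) :
    ∃ (V : Type u) (_ : Fintype V) (G : SimpleGraph V) (φ : V ↪ W) (a : V),
      φ a = u ∧ StarExt G H φ a v ∧ (Set.range φ)ᶜ = insert v {w | H.Adj v w ∧ w ≠ u} := by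
  classical
  have hr : ∀ x, x ∉ Set.range (Function.Embedding.subtype
      fun x : W => ¬ (x = v ∨ (H.Adj v x ∧ x ≠ u))) ↔ (x = v ∨ (H.Adj v x ∧ x ≠ u)) := fun x => by
    simp
    tauto
  refine ⟨{x // ¬ (x = v ∨ (H.Adj v x ∧ x ≠ u))}, inferInstance,
    H.comap (Function.Embedding.subtype _), Function.Embedding.subtype _,
    ⟨u, by rintro (h | h); exacts [huv.ne' h, h.2 rfl]⟩, rfl,
    ⟨⟨fun a b => Iff.rfl, fun a x hx => ?_, (hr v).2 (Or.inl rfl)⟩, fun x hx hxv => ?_,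
      fun x y hx hxv hy hyv hxy => ?_⟩, ?_⟩
  · constructor
    · intro h
      rcases (hr x).1 hx with rfl | ⟨h1, h2⟩
      · refine ⟨Subtype.ext ?_, rfl⟩
        by_contra hne
        exact a.2 (Or.inr ⟨h.symm, hne⟩)
      · exact absurd (Or.inl (hL x h1 h2 _ h.symm)) a.2
    · rintro ⟨rfl, rfl⟩
      exact huv.symm
  · exact (((hr x).1 hx).resolve_left hxv).1.symm
  · have := ((hr x).1 hx).resolve_left hxv
    exact hyv (hL x this.1 this.2 y hxy)
  · ext x
    exact hr x

theorem PendantExt.apply_mem_branch (P : PendantExt G H φ u v) {a b x : V}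
    (hx : x ∈ branch G a b) : φ x ∈ branch H (φ a) (φ b) := by
  have hba : b ≠ a := hx.1
  have key : branch G a b ⊆ {x | φ x ∈ branch H (φ a) (φ b)} := by
    refine branch_subset (mem_branch_self (φ.injective.ne hba)) fun c hc d hcd hda => ?_
    exact mem_branch_of_adj hc ((P.adj_iff _ _).2 hcd) (φ.injective.ne hda)
  exact key hx

theorem LeafExt.isHub (P : LeafExt G H φ u v) {X : Set V} {a b : V}
    (hH : IsHub H (φ '' X) (φ a) (φ b)) : IsHub G X a b := by
  refine ⟨hH.acyclic.comap ⟨φ, fun h => (P.adj_iff _ _).2 h⟩ φ.injective,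
    (P.adj_iff _ _).1 hH.adj, fun x hx hxX => ?_, ?_⟩
  · have := hH.near (φ x) (P.apply_mem_branch hx) ⟨x, hxX, rfl⟩
    rwa [φ.injective.eq_iff, P.adj_iff] at this
  · obtain ⟨_, h1, h2, ⟨w, hw, rfl⟩⟩ := hH.exists_demand
    exact ⟨w, (P.adj_iff _ _).1 h1, fun h => h2 (h ▸ rfl), hw⟩

end Restriction

/-! ### Finding hubs and removable endvertices -/

section Search

variable {V : Type u} {T : SimpleGraph V} {X : Set V} {u v : V}

theorem exists_mem_branch (hT : T.Connected) {x q : V} (hq : q ≠ x) :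
    ∃ w, T.Adj x w ∧ q ∈ branch T x w := by
  have := mem_of_connected hT (C := {q | q = x ∨ ∃ w, T.Adj x w ∧ q ∈ branch T x w}) (x := x)
    (Or.inl rfl) ?_ q
  · exact this.resolve_left hq
  · rintro a ha b hab
    by_cases hbx : b = x
    · exact Or.inl hbx
    · rcases ha with rfl | ⟨w, hw, ha⟩
      · exact Or.inr ⟨b, hab, mem_branch_self hbx⟩
      · exact Or.inr ⟨w, hw, mem_branch_of_adj ha hab hbx⟩

variable [Fintype V]

/-- A branch with a vertex of `X` that is not its root contains a hub. -/
theorem exists_isHub_of_branch (hT : T.IsAcyclic) (huv : T.Adj u v) {x : V}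
    (hx : x ∈ branch T u v) (hxX : x ∈ X) (hxv : x ≠ v) : ∃ u v, IsHub T X u v := by
  induction hn : (branch T u v).ncard using Nat.strong_induction_on generalizing u v x with
  | _ n ih =>
    -- Descend while a smaller branch has a demand off its root; when none does, `uv` is a hub.
    by_cases hcon : ∃ w y, T.Adj v w ∧ w ≠ u ∧ y ∈ branch T v w ∧ y ∈ X ∧ y ≠ w
    · obtain ⟨w, y, hvw, hwu, hy, hyX, hyw⟩ := hcon
      refine ih _ ?_ hvw hy hyX hyw rfl
      rw [← hn]
      exact Set.ncard_lt_ncard (branch_ssubset_branch hT huv hvw hwu) (Set.toFinite _)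
    · push Not at hcon
      refine ⟨u, v, hT, huv, fun y hy hyX => ?_, ?_⟩
      · rcases mem_branch_decomp hy with h | ⟨w, hw, hwu, hyw⟩
        · exact Or.inl h
        · rw [hcon w y hw hwu hyw hyX]
          exact Or.inr hw
      · obtain ⟨w, hw, hwu, hxw⟩ := (mem_branch_decomp hx).resolve_left hxv
        have := hcon w x hw hwu hxw hxX
        exact ⟨w, hw, hwu, this ▸ hxX⟩

/-- A strong tree with at least two vertices and nonempty `X` has a hub. -/
theorem exists_isHub (hT : T.IsTree) (hS : Strong T X) (hV : 1 < Fintype.card V)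
    (hX : X.Nonempty) : ∃ u v, IsHub T X u v := by
  classical
  by_contra hno
  -- Without a hub, every demanded vertex is adjacent to all other vertices, so `X` lies within an
  -- edge `xy`.
  have hbr : ∀ u v, T.Adj u v → ∀ x ∈ branch T u v, x ∈ X → x = v := fun u v huv x hx hxX => by
    by_contra hxv
    exact hno (exists_isHub_of_branch hT.isAcyclic huv hx hxX hxv)
  have hadj : ∀ x q, q ∈ X → q ≠ x → T.Adj x q := fun x q hq hqx => by
    obtain ⟨w, hw, hqw⟩ := exists_mem_branch hT.connected hqx
    rwa [hbr x w hw q hqw hq]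
  obtain ⟨x, hx⟩ := hX
  obtain ⟨y, hxy, hXxy⟩ : ∃ y, T.Adj x y ∧ ∀ q ∈ X, q = x ∨ q = y := by
    by_cases h : ∃ y ∈ X, y ≠ x
    · obtain ⟨y, hy, hyx⟩ := h
      refine ⟨y, hadj x y hy hyx, fun q hq => ?_⟩
      by_contra! hne
      exact not_adj_of_adj_of_adj hT.isAcyclic x y q (hadj x y hy hyx) (hadj x q hq hne.1)
        (hadj y q hq hne.2)
    · push Not at h
      obtain ⟨a, ha⟩ := Fintype.exists_ne_of_one_lt_card hV x
      obtain ⟨w, hw, -⟩ := exists_mem_branch hT.connected ha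
      exact ⟨w, hw, fun q hq => Or.inl (h q hq)⟩
  -- A single unit at `y` is a minimum weak function: it can move to `x`. It is not Roman, as `x`
  -- sees no 2.
  set g : V → ℕ := Function.update (fun _ => 0) y 1 with hg
  have hgx : g x = 0 := by simp [hg, hxy.ne]
  have hgy : g y = 1 := by simp [hg]
  have hg1 : ∀ a, g a ≤ 1 := fun a => by
    rcases eq_or_ne a y with rfl | h
    · omega
    · simp [hg, h]
  have hW : IsWRDF T X g := by
    refine ⟨fun a => mem_values_iff.2 ((hg1 a).trans one_le_two), fun q hq hq0 => ?_⟩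
    obtain rfl : q = x := by
      rcases hXxy q hq with h | rfl
      · exact h
      · omega
    refine isDefended_iff.2 ⟨y, hxy, by omega, fun a ha => ⟨q, ?_, Or.inl rfl⟩⟩
    rcases hXxy a ha with rfl | rfl
    · exact Or.inl rfl
    · exact Or.inr hxy.symm
  have hmin : IsMinWRDF T X g := by
    refine isMinWRDF_iff.2 ⟨hW, fun h hh => ?_⟩
    have h1 : weight g + 0 = weight (fun _ : V => 0) + 1 := weight_update (fun _ : V => 0) y 1
    have h2 : weight (fun _ : V => 0) = 0 := Finset.sum_const_zero
    have h3 : ∀ a, h a ≤ weight h := fun a =>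
      Finset.single_le_sum (fun _ _ => Nat.zero_le _) (Finset.mem_univ a)
    rcases hh.dominates hx with h4 | ⟨a, -, h4⟩
    · have := h3 x
      omega
    · have := h3 a
      omega
  obtain ⟨a, -, ha⟩ := (hS g hmin).2 x hx hgx
  have := hg1 a
  omega

/-- Walk away from `v` until an endvertex is reached. The invariant `v ∉ branch T p z`, with `p ≠
v`, keeps `z` from being adjacent to `v`. -/
theorem exists_endvertex_of_branch (hT : T.IsAcyclic) (huv : T.Adj u v) {p z : V} (hpz : T.Adj p z)
    (hp : p ∈ branch T u v) (hpv : p ≠ v) (hz : z ∈ branch T u v) (hv : v ∉ branch T p z) :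
    ∃ p z, T.Adj z p ∧ (∀ y, T.Adj z y → y = p) ∧ p ∈ branch T u v ∧ p ≠ v ∧ z ∈ branch T u v ∧
      z ≠ v ∧ ¬ T.Adj v z := by
  induction hn : (branch T p z).ncard using Nat.strong_induction_on generalizing p z with
  | _ n ih =>
    have hzself : z ∈ branch T p z := mem_branch_self hpz.ne'
    have hzv : z ≠ v := by rintro rfl; exact hv hzself
    by_cases hcon : ∃ q, T.Adj z q ∧ q ≠ p
    · obtain ⟨q, hzq, hqp⟩ := hcon
      have hss := branch_ssubset_branch hT hpz hzq hqp
      refine ih _ ?_ hzq hz hzv (mem_branch_of_adj_of_ne hT huv hz hzv hzq)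
        (fun h => hv (hss.subset h)) rfl
      rw [← hn]
      exact Set.ncard_lt_ncard hss (Set.toFinite _)
    · push Not at hcon
      exact ⟨p, z, hpz.symm, hcon, hp, hpv, hz, hzv,
        fun h => hv (mem_branch_of_adj hzself h.symm hpv.symm)⟩

/-- A branch that is not a star contains an endvertex at distance at least two from its root. -/
theorem exists_endvertex (hT : T.IsAcyclic) (huv : T.Adj u v) {x : V} (hx : x ∈ branch T u v)
    (hxv : x ≠ v) (hvx : ¬ T.Adj v x) :
    ∃ p z, T.Adj z p ∧ (∀ y, T.Adj z y → y = p) ∧ p ∈ branch T u v ∧ p ≠ v ∧ z ∈ branch T u v ∧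
      z ≠ v ∧ ¬ T.Adj v z := by
  obtain ⟨w, hvw, hwu, hxw⟩ := (mem_branch_decomp hx).resolve_left hxv
  have hwS : w ∈ branch T u v := mem_branch_of_adj (mem_branch_self huv.ne') hvw hwu
  obtain ⟨y, hwy, hyv⟩ : ∃ y, T.Adj w y ∧ y ≠ v := by
    by_contra! hno
    have : branch T v w ⊆ {w} := branch_subset rfl fun a ha b hab hbv => by
      rw [Set.mem_singleton_iff.1 ha] at hab
      exact absurd (hno b hab) hbv
    rw [this hxw] at hvx
    exact hvx hvw
  refine exists_endvertex_of_branch hT huv hwy hwS hvw.ne'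
    (mem_branch_of_adj_of_ne hT huv hwS hvw.ne' hwy) fun h => ?_
  exact hyv (eq_of_mem_branch_of_adj hT hwy h hvw.symm).symm

end Search

/-! ### Every member of `setS` is generated -/

section Backward

variable {A B : Triple.{u}}

theorem isAdmissible_of_mem_setS (hA : A ∈ setS) : A.IsAdmissible :=
  ⟨(mem_setS_iff.1 hA).1, (mem_setS_iff.1 hA).2.2 ▸ subset_coverable _ _⟩

/-- Since `Y` is determined by the tree and `X`, the forward direction already yields the `Y`
required of an operation. -/
theorem Y_eq_of_mem_setS {Y : Set B.V} (hB : B ∈ setS)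
    (h : (⟨B.V, B.fintypeV, B.T, B.X, Y⟩ : Triple.{u}) ∈ setS) : B.Y = Y :=
  (mem_setS_iff.1 hB).2.2.trans (mem_setS_iff.1 h).2.2.symm

/-- `B` arises by one of the operations from a smaller triple in `𝒮`. -/
def IsReducible (B : Triple.{u}) : Prop :=
  ∃ A ∈ setS.{u}, Fintype.card A.V < Fintype.card B.V ∧
    (Op1 A B ∨ Op2 A B ∨ Op3 A B ∨ Op4 A B ∨ Op5 A B)

/-- Removal of an endvertex `z` when the triple without the demand at `z` is strong. -/
theorem exists_removal {z p : B.V} (hT : B.T.IsTree) (hS : Strong B.T (B.X \ {z}))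
    (hzp : B.T.Adj z p) (hz : ∀ y, B.T.Adj z y → y = p) :
    ∃ A ∈ setS.{u}, Fintype.card A.V < Fintype.card B.V ∧ ∃ (φ : A.V ↪ B.V) (u : A.V),
      φ u = p ∧ LeafExt A.T B.T φ u z ∧ B.X \ {z} = φ '' A.X := by
  obtain ⟨V, hV, G, φ, u, hu, P⟩ := exists_leafExt hzp hz
  have hX : B.X \ {z} = φ '' (φ ⁻¹' (B.X \ {z})) := by
    rw [Set.image_preimage_eq_of_subset]
    rintro x ⟨-, hx⟩
    by_contra h
    exact hx (P.eq_of_notMem x h)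
  rw [hX] at hS
  exact ⟨⟨V, hV, G, φ ⁻¹' (B.X \ {z}), coverable G (φ ⁻¹' (B.X \ {z}))⟩,
    mem_setS_iff.2 ⟨P.isTree hT, P.strong_of_strong hS, rfl⟩, P.card_lt, φ, u, hu, P, hX⟩

theorem isReducible_of_endvertex {z p : B.V} (hB : B ∈ setS) (hz : z ∉ B.X) (hzp : B.T.Adj z p)
    (hzu : ∀ y, B.T.Adj z y → y = p) (hp : p ∉ B.Y) : IsReducible B := by
  obtain ⟨hT, hS, hY⟩ := mem_setS_iff.1 hB
  obtain ⟨A, hA, hcard, φ, u, rfl, P, hX⟩ :=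
    exists_removal hT (by rwa [Set.sdiff_singleton_eq_self hz]) hzp hzu
  rw [Set.sdiff_singleton_eq_self hz] at hX
  have hYA := (mem_setS_iff.1 hA).2.2
  rw [hX] at hS hY
  have hu : u ∉ coverable A.T A.X := by
    rwa [hY, P.apply_mem_coverable_iff hS] at hp
  refine ⟨A, hA, hcard, Or.inl ⟨isAdmissible_of_mem_setS hA, φ, u, z, hYA ▸ hu,
    P.arisesByAdding, hX, ?_⟩⟩
  rw [hY, hYA]
  refine P.coverable_eq_of_never_two hS fun g hg => ?_
  rw [apply_eq_zero_of_notMem_coverable hu hg]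
  omega

variable {u v : B.V}

/-- An endvertex beyond the neighbors of `v` is undemanded. If its neighbor is not coverable,
Operation 1 applies; otherwise that neighbor is adjacent to `v`, hence some `w i`, and Operation 5
applies. -/
theorem isReducible_of_far {x : B.V} (hB : B ∈ setS) (hH : IsHub B.T B.X u v)
    (hx : x ∈ branch B.T u v) (hxv : x ≠ v) (hvx : ¬ B.T.Adj v x) : IsReducible B := by
  obtain ⟨hT, hS, hY⟩ := mem_setS_iff.1 hB
  obtain ⟨p, z, hzp, hz, hp, hpv, hzb, hzv, hvz⟩ := exists_endvertex hH.acyclic hH.adj hx hxv hvx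
  have hzX : z ∉ B.X := fun h => (hH.near z hzb h).elim hzv hvz
  by_cases hpY : p ∈ B.Y
  swap
  · exact isReducible_of_endvertex hB hzX hzp hz hpY
  have hvp : B.T.Adj v p := hH.adj_of_mem_coverable hS hp hpv (hY ▸ hpY)
  obtain ⟨A, hA, hcard, φ, a, rfl, P, hX⟩ :=
    exists_removal hT (by rwa [Set.sdiff_singleton_eq_self hzX]) hzp hz
  rw [Set.sdiff_singleton_eq_self hzX] at hX
  obtain ⟨-, hSA, hYA⟩ := mem_setS_iff.1 hA
  obtain ⟨u, rfl⟩ := (P.cases u).resolve_left (ne_of_mem_branch hzb).symm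
  obtain ⟨v, rfl⟩ := (P.cases v).resolve_left hzv.symm
  rw [hX] at hS hY hH
  have hHA := P.isHub hH
  obtain ⟨k, w, hC⟩ := hHA.exists_isConfiguration hSA hYA
  have hva : A.T.Adj v a := (P.adj_iff _ _).1 hvp
  have hau : a ≠ u := fun h => ne_of_mem_branch hp (h ▸ rfl)
  obtain ⟨i, rfl⟩ := (hC.adj_iff.1 hva).resolve_left hau
  refine ⟨A, hA, hcard, Or.inr (Or.inr (Or.inr (Or.inr ⟨isAdmissible_of_mem_setS hA, φ, u, v, k, w,
    i, z, hC, P.arisesByAdding, hX, ?_⟩)))⟩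
  rw [hY, hYA]
  refine P.coverable_eq_of_never_two hS fun g hg => ?_
  rw [(hHA.apply_eq hSA hg).2 _ (hHA.mem_of_adj hva hau) hva.ne']
  omega

/-- An endvertex at a hub can be removed if enough demand remains. -/
theorem isReducible_of_hub_endvertex {z : B.V} (hB : B ∈ setS) (hS : Strong B.T (B.X \ {z}))
    (hH : IsHub B.T (B.X \ {z}) u v) (hvz : B.T.Adj v z) (hzu : z ≠ u)
    (hz : ∀ y, B.T.Adj z y → y = v) : IsReducible B := by
  have hT := (mem_setS_iff.1 hB).1
  obtain ⟨A, hA, hcard, φ, a, rfl, P, hX⟩ := exists_removal hT hS hvz.symm hz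
  obtain ⟨-, hSA, hYA⟩ := mem_setS_iff.1 hA
  obtain ⟨u, rfl⟩ := (P.cases u).resolve_left hzu.symm
  rw [hX] at hH
  obtain ⟨k, w, hC⟩ := (P.isHub hH).exists_isConfiguration hSA hYA
  have hBX : B.X = φ '' A.X ∨ B.X = φ '' A.X ∪ {z} := by
    rw [← hX]
    by_cases h : z ∈ B.X
    · exact Or.inr (by simp [h])
    · exact Or.inl (Set.sdiff_singleton_eq_self h).symm
  have key : ∀ Y, Y = φ '' A.Y ∪ {z} → Op4 A ⟨B.V, B.fintypeV, B.T, B.X, Y⟩ := fun Y hY =>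
    ⟨isAdmissible_of_mem_setS hA, φ, u, a, k, w, z, hC, P.arisesByAdding, hBX, hY⟩
  exact ⟨A, hA, hcard, Or.inr (Or.inr (Or.inr (Or.inl
    (key B.Y (Y_eq_of_mem_setS hB ((key _ rfl).mem_setS hA))))))⟩

theorem eq_union_insert_cases {W : Type u} {X I L : Set W} {p v : W}
    (h : ∀ x, x ∈ X ↔ x ∈ I ∨ (x = p ∧ p ∈ X) ∨ (x = v ∧ v ∈ X) ∨ x ∈ L) :
    (p ∉ X ∧ X = I ∪ L) ∨ (p ∈ X ∧ X = I ∪ insert p L) ∨ (p ∉ X ∧ X = I ∪ insert v L) ∨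
      (p ∈ X ∧ X = I ∪ insert p (insert v L)) := by
  by_cases hp : p ∈ X <;> by_cases hv : v ∈ X <;> simp only [hp, hv, and_true, and_false,
    false_or] at h
  · refine Or.inr (Or.inr (Or.inr ⟨hp, Set.ext fun x => (h x).trans ?_⟩))
    simp only [Set.mem_union, Set.mem_insert_iff]
  · refine Or.inr (Or.inl ⟨hp, Set.ext fun x => (h x).trans ?_⟩)
    simp only [Set.mem_union, Set.mem_insert_iff]
  · refine Or.inr (Or.inr (Or.inl ⟨hp, Set.ext fun x => (h x).trans ?_⟩))
    simp only [Set.mem_union, Set.mem_insert_iff]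
  · refine Or.inl ⟨hp, Set.ext fun x => (h x).trans ?_⟩
    simp only [Set.mem_union]

theorem isReducible_of_star (hB : B ∈ setS) (hH : IsHub B.T B.X u v)
    (hfar : ∀ x ∈ branch B.T u v, x = v ∨ B.T.Adj v x) : IsReducible B := by
  obtain ⟨hT, hS, hY⟩ := mem_setS_iff.1 hB
  have hleaf : ∀ w, B.T.Adj v w → w ≠ u → ∀ y, B.T.Adj w y → y = v := fun w hw hwu y hwy => by
    have hwb := hH.mem_of_adj hw hwu
    have hy := mem_branch_of_adj_of_ne hH.acyclic hH.adj hwb hw.ne' hwy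
    exact (hfar y hy).resolve_right fun h => not_adj_of_adj_of_adj hH.acyclic v w y hw h hwy
  by_cases hall : ∀ w, B.T.Adj v w → w ≠ u → w ∈ B.X
  swap
  · push Not at hall
    obtain ⟨z, hvz, hzu, hzX⟩ := hall
    have hd := Set.sdiff_singleton_eq_self hzX
    exact isReducible_of_hub_endvertex hB (by rwa [hd]) (by rwa [hd]) hvz hzu (hleaf z hvz hzu)
  obtain ⟨V, hV, G, φ, u, rfl, P, hr⟩ := exists_starExt hH.adj.symm hleaf
  have hr' : ∀ x, x ∉ Set.range φ ↔ x = v ∨ (B.T.Adj v x ∧ x ≠ φ u) := fun x => by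
    rw [← Set.mem_compl_iff, hr]
    rfl
  have hvL : v ∉ {w | B.T.Adj v w ∧ w ≠ φ u} := fun h => h.1.ne rfl
  -- The star serves `u` for free, so the smaller triple drops any demand there.
  have D : DemandExt φ u (φ ⁻¹' B.X \ {u}) B.X := by
    refine ⟨?_, fun x hx => ?_, fun h => h.2 rfl⟩
    · rintro _ ⟨x, hx, rfl⟩
      exact hx.1
    · by_cases hxr : x ∈ Set.range φ
      · obtain ⟨a, rfl⟩ := hxr
        by_cases hau : a = u
        · exact Or.inl (Or.inr (by rw [hau]; rfl))
        · exact Or.inl (Or.inl ⟨a, ⟨hx, hau⟩, rfl⟩)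
      · exact Or.inr hxr
  have hdem : ∀ w, B.T.Adj v w → w ≠ φ u → IsDemandingLeaf φ v B.X w := fun w hw hwu =>
    ⟨(hr' w).2 (Or.inr ⟨hw, hwu⟩), hw.ne', hall w hw hwu⟩
  obtain ⟨a, b, ⟨hva, hau, haX⟩, ⟨hvb, hbu, hbX⟩, hab, -⟩ := hH.exists_demands hS
  have ha := hdem a hva hau
  have hb := hdem b hvb hbu
  have hSG := P.strong_of_strong D ha hb hab hS
  set A : Triple.{u} := ⟨V, hV, G, φ ⁻¹' B.X \ {u}, coverable G (φ ⁻¹' B.X \ {u})⟩ with hAdef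
  have hA : A ∈ setS := mem_setS_iff.2 ⟨P.isTree hT, hSG, rfl⟩
  have hcard : Fintype.card A.V < Fintype.card B.V := P.card_lt
  have memX : ∀ x, x ∈ B.X ↔ x ∈ φ '' A.X ∨ (x = φ u ∧ φ u ∈ B.X) ∨ (x = v ∧ v ∈ B.X) ∨
      x ∈ {w | B.T.Adj v w ∧ w ≠ φ u} := fun x => by
    constructor
    · intro hx
      rcases D.subset hx with (h | h) | h
      · exact Or.inl h
      · obtain rfl : x = φ u := h
        exact Or.inr (Or.inl ⟨rfl, hx⟩)
      · rcases (hr' x).1 h with rfl | h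
        · exact Or.inr (Or.inr (Or.inl ⟨rfl, hx⟩))
        · exact Or.inr (Or.inr (Or.inr h))
    · rintro (h | ⟨rfl, h⟩ | ⟨rfl, h⟩ | ⟨h1, h2⟩)
      exacts [D.image_subset h, h, h, hall x h1 h2]
  -- Two, three, or more leaves lead to Operations 2, 3 and 4, respectively.
  by_cases h2 : ∀ w, B.T.Adj v w → w ≠ φ u → w = a ∨ w = b
  · have hL : {w | B.T.Adj v w ∧ w ≠ φ u} = {a, b} := by
      ext x
      constructor
      · rintro ⟨h1, h3⟩
        exact h2 x h1 h3
      · rintro (rfl | rfl)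
        exacts [⟨hva, hau⟩, ⟨hvb, hbu⟩]
    have hL' : ∀ x, B.T.Adj v x ∧ x ≠ φ u ↔ x = a ∨ x = b := fun x => by
      have := Set.ext_iff.1 hL x
      simpa using this
    obtain ⟨huX, huY⟩ := P.notMem_coverable D ha hb hab (fun x hx => by
      rwa [hr', hL'] at hx) hS
    have hadd := P.arisesByAdding hr hvL
    rw [hL, starEdges_two] at hadd
    have hBX : B.X = φ '' A.X ∪ {φ u, a, b} ∨ B.X = φ '' A.X ∪ {φ u, v, a, b} := by
      rw [hL] at memX
      rcases eq_union_insert_cases memX with h | h | h | h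
      exacts [absurd huX h.1, Or.inl h.2, absurd huX h.1, Or.inr h.2]
    have key : ∀ Y, Y = φ '' A.Y ∪ {φ u, v, a, b} → Op2 A ⟨B.V, B.fintypeV, B.T, B.X, Y⟩ :=
      fun Y hY => ⟨isAdmissible_of_mem_setS hA, φ, u, v, a, b, huY,
        by simp [hva.ne, hvb.ne, hab], hadd, hBX, hY⟩
    exact ⟨A, hA, hcard, Or.inr (Or.inl
      (key B.Y (Y_eq_of_mem_setS hB ((key _ rfl).mem_setS hA))))⟩
  push Not at h2
  obtain ⟨c, hvc, hcu, hca, hcb⟩ := h2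
  have hc := hdem c hvc hcu
  by_cases h3 : ∀ w, B.T.Adj v w → w ≠ φ u → w = a ∨ w = b ∨ w = c
  · have hL : {w | B.T.Adj v w ∧ w ≠ φ u} = {a, b, c} := by
      ext x
      constructor
      · rintro ⟨h1, h2⟩
        exact h3 x h1 h2
      · rintro (rfl | rfl | rfl)
        exacts [⟨hva, hau⟩, ⟨hvb, hbu⟩, ⟨hvc, hcu⟩]
    have hadd := P.arisesByAdding hr hvL
    rw [hL, starEdges_three] at hadd
    have hBX : B.X = φ '' A.X ∪ {a, b, c} ∨ B.X = φ '' A.X ∪ {φ u, a, b, c} ∨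
        B.X = φ '' A.X ∪ {v, a, b, c} ∨ B.X = φ '' A.X ∪ {φ u, v, a, b, c} := by
      rw [hL] at memX
      exact (eq_union_insert_cases memX).imp And.right
        (Or.imp And.right (Or.imp And.right And.right))
    have key : ∀ Y, Y = φ '' A.Y ∪ {φ u, v, a, b, c} → Op3 A ⟨B.V, B.fintypeV, B.T, B.X, Y⟩ :=
      fun Y hY => ⟨isAdmissible_of_mem_setS hA, φ, u, v, a, b, c, D.notMem,
        by simp [hva.ne, hvb.ne, hvc.ne, hab, hca.symm, hcb.symm], hadd, hBX, hY⟩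
    exact ⟨A, hA, hcard, Or.inr (Or.inr (Or.inl
      (key B.Y (Y_eq_of_mem_setS hB ((key _ rfl).mem_setS hA)))))⟩
  push Not at h3
  obtain ⟨z, hvz, hzu, hza, hzb, hzc⟩ := h3
  have hzr : z ∉ Set.range φ := (hr' z).2 (Or.inr ⟨hvz, hzu⟩)
  have D' : DemandExt φ u (φ ⁻¹' B.X \ {u}) (B.X \ {z}) := by
    refine ⟨fun x hx => ⟨D.image_subset hx, ?_⟩, Set.sdiff_subset.trans D.subset, D.notMem⟩
    rintro rfl
    exact hzr (Set.image_subset_range _ _ hx)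
  have hdem' : ∀ w, IsDemandingLeaf φ v B.X w → z ≠ w → IsDemandingLeaf φ v (B.X \ {z}) w :=
    fun w hw hzw => ⟨hw.1, hw.2.1, hw.2.2, hzw.symm⟩
  have ha' := hdem' a ha hza
  have hb' := hdem' b hb hzb
  have hc' := hdem' c hc hzc
  -- Without the demand at the fourth leaf `z`, the leaves `a`, `b`, `c` still force 2 at the
  -- center.
  have hS' : Strong B.T (B.X \ {z}) := P.strong D' ha' hb' hab (fun h hh =>
    P.center_eq_two_of_three D' ha' hb' hc' hab hca.symm hcb.symm hh) hSG
  exact isReducible_of_hub_endvertex hB hS' ⟨hH.acyclic, hH.adj, fun x hx hxX =>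
    hH.near x hx hxX.1, a, hva, hau, ha'.2.2⟩ hvz hzu (hleaf z hvz hzu)

theorem isReducible_of_mem_setS (hB : B ∈ setS) (hcard : 1 < Fintype.card B.V) :
    IsReducible B := by
  classical
  obtain ⟨hT, hS, hY⟩ := mem_setS_iff.1 hB
  rcases B.X.eq_empty_or_nonempty with hX | hX
  · have : Nontrivial B.V := Fintype.one_lt_card_iff_nontrivial.1 hcard
    obtain ⟨z, hz⟩ := hT.exists_vert_degree_one_of_nontrivial
    obtain ⟨p, hp, huniq⟩ := SimpleGraph.degree_eq_one_iff_existsUnique_adj.1 hz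
    refine isReducible_of_endvertex hB (by simp [hX]) hp huniq ?_
    rw [hY, hX, coverable_empty]
    exact Set.notMem_empty p
  · obtain ⟨u, v, hH⟩ := exists_isHub hT hS hcard hX
    by_cases hfar : ∀ x ∈ branch B.T u v, x = v ∨ B.T.Adj v x
    · exact isReducible_of_star hB hH hfar
    · push Not at hfar
      obtain ⟨x, hx, hxv, hvx⟩ := hfar
      exact isReducible_of_far hB hH hx hxv hvx

theorem generated_of_mem_setS (hB : B ∈ setS) : Generated B := by
  induction hn : Fintype.card B.V using Nat.strong_induction_on generalizing B with
  | _ n ih =>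
    obtain ⟨hT, hS, hY⟩ := mem_setS_iff.1 hB
    have := hT.connected.nonempty
    have hpos : 0 < Fintype.card B.V := Fintype.card_pos
    by_cases hcard : 1 < Fintype.card B.V
    · obtain ⟨A, hA, hlt, hop⟩ := isReducible_of_mem_setS hB hcard
      exact Generated.step A B (ih _ (hn ▸ hlt) hA rfl) hop
    · have h1 : Fintype.card B.V = 1 := by omega
      have := Fintype.card_le_one_iff_subsingleton.1 h1.le
      rcases B.X.eq_empty_or_nonempty with hX | hX
      · exact Generated.base_empty B h1 hX (by rw [hY, hX, coverable_empty])
      · have hX' := hX.eq_univ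
        refine Generated.base_full B h1 hX' ?_
        rw [hY, ← Set.univ_subset_iff, ← hX']
        exact subset_coverable _ _

end Backward

end RomanTrees

theorem theorem2 :
    RomanTrees.setS.{u} = RomanTrees.setT.{u} ∧
      ∀ (V : Type u) [inst : Fintype V] (T : SimpleGraph V), T.IsTree →
        (RomanTrees.StronglyEqual T ↔
          (⟨V, inst, T, Set.univ, Set.univ⟩ : RomanTrees.Triple.{u}) ∈ RomanTrees.setT.{u}) := by
  have h : RomanTrees.setS.{u} = RomanTrees.setT.{u} :=
    Set.ext fun _ => ⟨RomanTrees.generated_of_mem_setS, RomanTrees.Generated.mem_setS⟩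
  refine ⟨h, fun V inst T hT => ?_⟩
  rw [← h, RomanTrees.mem_setS_iff]
  -- When every vertex is demanded, every vertex is coverable, so the condition on `Y` holds
  -- automatically.
  exact ⟨fun hS => ⟨hT, hS, (Set.univ_subset_iff.1 (RomanTrees.subset_coverable T _)).symm⟩,
    fun hS => hS.2.1⟩
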